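/- Let $K\ge 1$ and $N\ge 1$ be coprime integers. Let $z$ be the affine coordinate on $\mathbb{C}\subset\mathbb{CP}^1$ and $x=1/z$; for a local parameter $t$ write $\mathbb{C}\{t\}$ and $\mathbb{C}(\{t\})$ for the germs at $t=0$ of holomorphic and of meromorphic functions of $t$. **Filtered bundles.** A filtered bundle of rank $K$ on $(\mathbb{CP}^1,\{\infty\})$ is a locally free $\mathcal{O}(*\infty)$-module $\mathcal{E}$ of rank $K$ (where $\mathcal O(*\infty)$ is the sheaf of rational functions with poles at most at $\infty$) with an increasing filtration by locally free $\mathcal{O}$-submodules $\mathcal{P}_\alpha\mathcal{E}$, $\alpha\in\mathbb{R}$, such that $\mathcal{P}_\alpha\mathcal{E}=\mathcal{E}$ on $\mathbb{C}$, $\mathcal{P}_\alpha\mathcal{E}=\bigcap_{\beta>\alpha}\mathcal{P}_\beta\mathcal{E}$, and $\mathcal{P}_{\alpha-1}\mathcal{E}=x\,\mathcal{P}_\alpha\mathcal{E}$ near $\infty$. Concretely: the module $E$ of global sections of $\mathcal{E}$ is a finitely generated projective $\mathbb{C}[z]$-module of rank $K$, and the filtration is a family of $\mathbb{C}\{x\}$-lattices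 $\mathcal{P}_\alpha$ in the germ $\mathbb{C}(\{x\})\otimes_{\mathbb{C}[z]}E$ of $\mathcal{E}$ at $\infty$ with these properties. The order at $\infty$ of a section $s$ is $\nu_\infty(s)=\inf\{\alpha: s\in\mathcal{P}_\alpha\}$. For $\alpha\in\mathbb{R}$, $\mathcal{O}(\alpha)$ is $\mathcal{O}(*\infty)$ with $\mathcal{P}_\beta$ consisting of the germs of pole order at most $\alpha+\beta$ at $\infty$. Direct sums are filtered by $\mathcal P_\alpha(\mathcal E\oplus\mathcal E')=\mathcal P_\alpha\mathcal E\oplus\mathcal P_\alpha\mathcal E'$, and exterior powers carry the filtration induced from tensor powers. **Higgs bundles.** A filtered $SL(K)$-Higgs bundle $(\mathcal{E},\varphi)$ is a filtered bundle $\mathcal{E}$ of rank $K$ with a global section $\omega$ of $\bigwedge^K\mathcal{E}$ that trivializes it on $\mathbb{C}$ and has $\nu_\infty(\omega)=0$, and a traceless section $\varphi$ of $\mathrm{End}\,\mathcal{E}\otimes K_{\mathbb{CP}^1}$, holomorphic on $\mathbb{C}$ and meromorphic at $\infty$ (so $\varphi=\bar\varphi\,dz$ with $\bar\varphi\in\mathrm{End}_{\mathbb{C}[z]}(E)$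 of trace $0$). **The category $\mathcal{C}_{K,N}$.** Its objects are the filtered $SL(K)$-Higgs bundles with the following property. Let $\psi$ be the covering $x=u^{2K}$ near $\infty$, and give $\psi^*\mathcal{E}$ the natural filtration, in which $\mathcal{P}_a$ is generated over $\mathbb C\{u\}$ by the sections $u^{-n}\psi^*s$ with $n\in\mathbb{Z}$, $s\in\mathcal{P}_b\mathcal{E}$ and $n+2Kb\le a$. Then near $u=0$ there is a decomposition $\psi^*\mathcal{E}=\bigoplus_{r=1}^K\mathcal{L}_r$ into filtered line bundles, preserved by $\psi^*\varphi$, such that each $\mathcal{L}_r$ is isomorphic to an ordinary line bundle filtered by pole order at $u=0$, and such that $\psi^*\varphi-d\mathfrak{a}_r$ maps $\mathcal{P}_a\mathcal{L}_r$ into $\mathcal{P}_{a+1}\mathcal{L}_r\otimes du$ for all $a$, where $$\mathfrak{a}_r=\frac{K}{K+N}\,e^{2\pi i r/K}\,u^{-2(N+K)}.$$ Morphisms are isomorphisms of filtered bundles that preserve the Higgs fields. $\mathcal{M}_{K,N}$ is the set of isomorphism classes of objects. **Cyclic partitions.** An ordered $K$-partition of $N$ is a tuple $(b_1,\dots,b_K)$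 of non-negative integers with sum $N$. A cyclic $K$-partition $[\mathbf{b}]$ of $N$ is an equivalence class of these under cyclic permutation of the indices. Indices are read modulo $K$ below. **Proposition.** Let $(\mathcal{E},\varphi)$ be an object of $\mathcal{C}_{K,N}$. 1. There are filtered line bundles $\mathcal{L}_i\simeq\mathcal{O}(\alpha_i)$, $\alpha_i\in\mathbb{R}$, and a decomposition of filtered bundles $\mathcal{E}=\bigoplus_{i=1}^K\mathcal{L}_i$. 2. The summands of any such decomposition can be ordered so that the numbers $b_i$ defined by $b_i-\frac{N}{K}=\alpha_i-\alpha_{i+1}$ are integers. For every such ordering, $b_i\ge 0$ for all $i$ and $\sum_i b_i=N$. 3. The resulting cyclic $K$-partition $[\mathbf{b}]$ of $N$ depends only on $(\mathcal{E},\varphi)$, not on the decomposition or on the ordering. Moreover, let $\mathcal{M}_{K,N}^{[\mathbf{b}]}$ be the set of classes of objects with cyclic partition $[\mathbf{b}]$. Then $\mathcal{M}_{K,N}$ is the disjoint union of the $\mathcal{M}_{K,N}^{[\mathbf{b}]}$ over all cyclic $K$-partitions $[\mathbf{b}]$ of $N$. (Non-emptiness of the strata is not claimed.) -/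

import Mathlib

open Filter Topology Polynomial TensorProduct

/-! ### Germs of meromorphic functions

`z` is the affine coordinate on `ℂ ⊂ ℂℙ¹`. For `m ≥ 1` let `u` be the local parameter with
`z = u⁻ᵐ`. For `m = 1` this is the local coordinate `x = 1/z` at `∞`; for general `m` it is the
coordinate on the `m`-fold cover `x = uᵐ` of a disc around `∞`. -/

/-- Germs at the origin of functions that are meromorphic at the origin. -/
def meromorphicGerms : Subring (Germ (𝓝[≠] (0 : ℂ)) ℂ) where
  carrier := {g | ∃ f : ℂ → ℂ, MeromorphicAt f 0 ∧ (f : Germ (𝓝[≠] (0 : ℂ)) ℂ) = g}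
  mul_mem' := by
    rintro _ _ ⟨f, hf, rfl⟩ ⟨g, hg, rfl⟩
    exact ⟨f * g, hf.mul hg, rfl⟩
  one_mem' := ⟨fun _ => 1, MeromorphicAt.const 1 0, rfl⟩
  add_mem' := by
    rintro _ _ ⟨f, hf, rfl⟩ ⟨g, hg, rfl⟩
    exact ⟨f + g, hf.add hg, rfl⟩
  zero_mem' := ⟨fun _ => 0, MeromorphicAt.const 0 0, rfl⟩
  neg_mem' := by
    rintro _ ⟨f, hf, rfl⟩
    exact ⟨-f, hf.neg, rfl⟩

/-- The field `ℂ({u})` of germs at `u = 0` of meromorphic functions of `u`, where `z = u⁻ᵐ`.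
The index `m` only serves to make this field a `ℂ[z]`-algebra. -/
def MeroGerm (_m : ℕ) : Type := meromorphicGerms

noncomputable instance MeroGerm.instCommRing (m : ℕ) : CommRing (MeroGerm m) :=
  inferInstanceAs (CommRing meromorphicGerms)

/-- The germ of a function that is meromorphic at `0`. -/
noncomputable def MeroGerm.of (m : ℕ) (f : ℂ → ℂ) (hf : MeromorphicAt f 0) : MeroGerm m :=
  ⟨(f : Germ (𝓝[≠] (0 : ℂ)) ℂ), f, hf, rfl⟩

theorem MeroGerm.of_surjective (m : ℕ) (g : MeroGerm m) :
    ∃ (f : ℂ → ℂ) (hf : MeromorphicAt f 0), MeroGerm.of m f hf = g := by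
  obtain ⟨g, f, hf, rfl⟩ := g
  exact ⟨f, hf, rfl⟩

theorem MeroGerm.of_eq_of {m : ℕ} {f g : ℂ → ℂ} (hf : MeromorphicAt f 0)
    (hg : MeromorphicAt g 0) :
    MeroGerm.of m f hf = MeroGerm.of m g hg ↔ f =ᶠ[𝓝[≠] (0 : ℂ)] g := by
  rw [← Germ.coe_eq]
  exact Subtype.ext_iff

theorem meromorphicAt_zpow (n : ℤ) : MeromorphicAt (fun u : ℂ => u ^ n) 0 :=
  (MeromorphicAt.id (0 : ℂ)).zpow n

/-- The germ of `u ↦ uⁿ`. -/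
noncomputable def MeroGerm.uPow (m : ℕ) (n : ℤ) : MeroGerm m :=
  MeroGerm.of m (fun u => u ^ n) (meromorphicAt_zpow n)

theorem MeroGerm.uPow_zero (m : ℕ) : MeroGerm.uPow m 0 = 1 :=
  (MeroGerm.of_eq_of _ (MeromorphicAt.const 1 0)).2 (Eventually.of_forall fun u => zpow_zero u)

theorem MeroGerm.uPow_add (m : ℕ) (a b : ℤ) :
    MeroGerm.uPow m (a + b) = MeroGerm.uPow m a * MeroGerm.uPow m b :=
  (MeroGerm.of_eq_of _ ((meromorphicAt_zpow a).mul (meromorphicAt_zpow b))).2 <| by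
    filter_upwards [self_mem_nhdsWithin] with u hu
    exact zpow_add₀ hu a b

/-- A polynomial in `z`, seen as a germ of meromorphic function of `u` through `z = u⁻ᵐ`. -/
noncomputable def MeroGerm.ofPolynomial (m : ℕ) : ℂ[X] →+* MeroGerm m :=
  Polynomial.eval₂RingHom
    { toFun := fun c => MeroGerm.of m (fun _ => c) (MeromorphicAt.const c 0)
      map_one' := rfl
      map_mul' := fun _ _ => rfl
      map_zero' := rfl
      map_add' := fun _ _ => rfl }
    (MeroGerm.uPow m (-(m : ℤ)))

noncomputable instance MeroGerm.instAlgebra (m : ℕ) : Algebra ℂ[X] (MeroGerm m) :=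
  (MeroGerm.ofPolynomial m).toAlgebra

/-- The ring `ℂ{u}` of germs at `u = 0` of holomorphic functions of `u`. -/
def HoloGerm (m : ℕ) : Subring (MeroGerm m) where
  carrier := {g | ∃ (f : ℂ → ℂ) (hf : AnalyticAt ℂ f 0), MeroGerm.of m f hf.meromorphicAt = g}
  mul_mem' := by
    rintro _ _ ⟨f, hf, rfl⟩ ⟨g, hg, rfl⟩
    exact ⟨f * g, hf.mul hg, rfl⟩
  one_mem' := ⟨fun _ => 1, analyticAt_const, rfl⟩
  add_mem' := by
    rintro _ _ ⟨f, hf, rfl⟩ ⟨g, hg, rfl⟩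
    exact ⟨f + g, hf.add hg, rfl⟩
  zero_mem' := ⟨fun _ => 0, analyticAt_const, rfl⟩
  neg_mem' := by
    rintro _ ⟨f, hf, rfl⟩
    exact ⟨-f, hf.neg, rfl⟩

theorem tendsto_pow_punctured (m : ℕ) [NeZero m] :
    Tendsto (fun u : ℂ => u ^ m) (𝓝[≠] (0 : ℂ)) (𝓝[≠] (0 : ℂ)) := by
  refine tendsto_nhdsWithin_iff.2 ⟨?_, ?_⟩
  · have h : Tendsto (fun u : ℂ => u ^ m) (𝓝 0) (𝓝 ((0 : ℂ) ^ m)) := (continuous_pow m).tendsto 0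
    rw [zero_pow (NeZero.ne m)] at h
    exact h.mono_left nhdsWithin_le_nhds
  · filter_upwards [self_mem_nhdsWithin] with u hu
    exact pow_ne_zero m hu

/-- Substitution `x = uᵐ` on germs. -/
noncomputable def MeroGerm.pullbackRingHom (m : ℕ) [NeZero m] : MeroGerm 1 →+* MeroGerm m where
  toFun g := ⟨g.1.compTendsto (fun u : ℂ => u ^ m) (tendsto_pow_punctured m), by
    obtain ⟨g, f, hf, rfl⟩ := g
    refine ⟨fun u => f (u ^ m), ?_, rfl⟩
    have h0 : MeromorphicAt f ((fun u : ℂ => u ^ m) 0) := by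
      simpa [zero_pow (NeZero.ne m)] using hf
    have h1 : AnalyticAt ℂ (fun u : ℂ => u ^ m) 0 := by fun_prop
    exact MeromorphicAt.comp_analyticAt (f := f) (g := fun u : ℂ => u ^ m) h0 h1⟩
  map_one' := rfl
  map_mul' := by
    rintro ⟨_, f, hf, rfl⟩ ⟨_, g, hg, rfl⟩
    rfl
  map_zero' := rfl
  map_add' := by
    rintro ⟨_, f, hf, rfl⟩ ⟨_, g, hg, rfl⟩
    rfl

/-- The pullback `ψ^*` of germs along the ramified covering `ψ : u ↦ x = uᵐ`; it is compatible
with the coordinate `z`. -/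
noncomputable def MeroGerm.pullback (m : ℕ) [NeZero m] : MeroGerm 1 →ₐ[ℂ[X]] MeroGerm m where
  __ := MeroGerm.pullbackRingHom m
  commutes' := by
    intro p
    have h : (MeroGerm.pullbackRingHom m).comp (MeroGerm.ofPolynomial 1)
        = MeroGerm.ofPolynomial m := by
      refine Polynomial.ringHom_ext (fun c => ?_) ?_
      · simp only [RingHom.comp_apply, MeroGerm.ofPolynomial, Polynomial.coe_eval₂RingHom,
          Polynomial.eval₂_C]
        rfl
      · simp only [RingHom.comp_apply, MeroGerm.ofPolynomial, Polynomial.coe_eval₂RingHom,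
          Polynomial.eval₂_X]
        refine (MeroGerm.of_eq_of
          (f := fun u : ℂ => (u ^ m) ^ (-((1 : ℕ) : ℤ))) (m := m) ?_ (meromorphicAt_zpow _)).2 ?_
        · exact ((MeromorphicAt.id (0 : ℂ)).pow m).zpow _
        · refine Eventually.of_forall fun u => ?_
          simp
    exact RingHom.congr_fun h p

/-! ### Filtered bundles on `(ℂℙ¹, {∞})` -/

/-- The germ at `∞` (for `m = 1`), or at the point `u = 0` of the `m`-fold cover near `∞`, of the
module with global sections `M`. -/
abbrev GermModule (m : ℕ) (M : Type*) [AddCommGroup M] [Module ℂ[X] M] : Type _ :=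
  MeroGerm m ⊗[ℂ[X]] M

/-- A filtered bundle of rank `K` on `(ℂℙ¹, {∞})`.

A locally free `𝒪(*∞)`-module `ℰ` of rank `K` on `ℂℙ¹` is given by its module `Sec` of global
sections, a locally free module of rank `K` over `H⁰(ℂℙ¹, 𝒪(*∞)) = ℂ[z]`; its germ at `∞` is
`ℂ({x}) ⊗ Sec`, with `x = 1/z`. An `𝒪`-submodule `𝒫_α ℰ` that is locally free and agrees with `ℰ`
away from `∞` is given by its germ at `∞`, a `ℂ{x}`-lattice in `ℂ({x}) ⊗ Sec`. -/
structure FilteredBundle.{u} (K : ℕ) where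
  Sec : Type u
  [addCommGroup : AddCommGroup Sec]
  [module : Module ℂ[X] Sec]
  finite : Module.Finite ℂ[X] Sec
  projective : Module.Projective ℂ[X] Sec
  rank : Module.finrank ℂ[X] Sec = K
  /-- The germ at `∞` of `𝒫_α ℰ`. -/
  P : ℝ → Submodule (HoloGerm 1) (GermModule 1 Sec)
  fg : ∀ α, (P α).FG
  span : ∀ α, Submodule.span (MeroGerm 1) (P α : Set (GermModule 1 Sec)) = ⊤
  mono : Monotone P
  rightCont : ∀ α, P α = ⨅ β, ⨅ _ : α < β, P β
  shift : ∀ α v, v ∈ P (α - 1) ↔ ∃ w ∈ P α, v = MeroGerm.uPow 1 1 • w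

attribute [instance] FilteredBundle.addCommGroup FilteredBundle.module

/-- The germ at `∞` of a filtered bundle. -/
abbrev FilteredBundle.Germ {K : ℕ} (E : FilteredBundle K) : Type _ := GermModule 1 E.Sec

/-- The map induced on germs by a linear map of global sections. -/
noncomputable abbrev germMap (m : ℕ) {M M' : Type*} [AddCommGroup M] [Module ℂ[X] M]
    [AddCommGroup M'] [Module ℂ[X] M'] (f : M →ₗ[ℂ[X]] M') :
    GermModule m M →ₗ[MeroGerm m] GermModule m M' :=
  f.baseChange (MeroGerm m)

/-- An isomorphism of filtered bundles. -/
structure FilteredBundle.Iso.{u, v} {K : ℕ} (E : FilteredBundle.{u} K)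
    (E' : FilteredBundle.{v} K) where
  equiv : E.Sec ≃ₗ[ℂ[X]] E'.Sec
  mem_iff : ∀ α v, v ∈ E.P α ↔ germMap 1 (equiv : E.Sec →ₗ[ℂ[X]] E'.Sec) v ∈ E'.P α

theorem MeroGerm.uPow_mem_holoGerm (m : ℕ) {n : ℤ} (hn : 0 ≤ n) :
    MeroGerm.uPow m n ∈ HoloGerm m := by
  obtain ⟨k, rfl⟩ := Int.eq_ofNat_of_zero_le hn
  refine ⟨fun u => u ^ k, by fun_prop, ?_⟩
  exact (MeroGerm.of_eq_of _ _).2 (Eventually.of_forall fun u => (zpow_natCast u k).symm)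

/-- The filtered line bundle `𝒪(α)`: the module `𝒪(*∞)` itself, filtered by the pole order at `∞`
shifted by `-α`. So a germ `g` lies in `𝒫_β` if its pole order is at most `α + β`, that is, if `g`
is a holomorphic multiple of `x ^ (-⌊α + β⌋)`. -/
noncomputable def lineBundle (α : ℝ) : FilteredBundle.{0} 1 where
  Sec := ℂ[X]
  finite := inferInstance
  projective := inferInstance
  rank := Module.finrank_self _
  P β := Submodule.span (HoloGerm 1) {MeroGerm.uPow 1 (-⌊α + β⌋) ⊗ₜ[ℂ[X]] (1 : ℂ[X])}
  fg β := Submodule.fg_span_singleton _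
  span β := by
    rw [eq_top_iff]
    intro v _
    induction v using TensorProduct.induction_on with
    | zero => exact Submodule.zero_mem _
    | add v w hv hw => exact Submodule.add_mem _ (hv trivial) (hw trivial)
    | tmul f p =>
      have h : f ⊗ₜ[ℂ[X]] p = ((p • f) * MeroGerm.uPow 1 ⌊α + β⌋) •
          (MeroGerm.uPow 1 (-⌊α + β⌋) ⊗ₜ[ℂ[X]] (1 : ℂ[X])) := by
        rw [TensorProduct.smul_tmul', smul_eq_mul, mul_assoc, ← MeroGerm.uPow_add,
          add_neg_cancel, MeroGerm.uPow_zero, mul_one, TensorProduct.smul_tmul, smul_eq_mul,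
          mul_one]
      rw [h]
      exact Submodule.smul_mem _ _ (Submodule.subset_span (Submodule.subset_span rfl))
  mono := by
    intro β γ h
    rw [Submodule.span_singleton_le_iff_mem, Submodule.mem_span_singleton]
    have hn : 0 ≤ ⌊α + γ⌋ - ⌊α + β⌋ := sub_nonneg.2 (Int.floor_le_floor (by linarith))
    refine ⟨⟨_, MeroGerm.uPow_mem_holoGerm 1 hn⟩, ?_⟩
    rw [TensorProduct.smul_tmul', Subring.smul_def, smul_eq_mul, ← MeroGerm.uPow_add]
    congr 2
    ring
  rightCont := by
    intro β
    apply le_antisymm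
    · refine le_iInf fun γ => le_iInf fun h => ?_
      rw [Submodule.span_singleton_le_iff_mem, Submodule.mem_span_singleton]
      have hn : 0 ≤ ⌊α + γ⌋ - ⌊α + β⌋ := sub_nonneg.2 (Int.floor_le_floor (by linarith))
      refine ⟨⟨_, MeroGerm.uPow_mem_holoGerm 1 hn⟩, ?_⟩
      rw [TensorProduct.smul_tmul', Subring.smul_def, smul_eq_mul, ← MeroGerm.uPow_add]
      congr 2
      ring
    · have h1 : α + β < ⌊α + β⌋ + 1 := Int.lt_floor_add_one _
      have h2 : (⌊α + β⌋ : ℝ) ≤ α + β := Int.floor_le _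
      set γ : ℝ := β + (⌊α + β⌋ + 1 - (α + β)) / 2 with hγ
      have h3 : β < γ := by linarith
      have h4 : ⌊α + γ⌋ = ⌊α + β⌋ := by
        rw [Int.floor_eq_iff]
        constructor <;> linarith
      refine (iInf₂_le γ h3).trans ?_
      rw [h4]
  shift := by
    intro β v
    have h : ⌊α + (β - 1)⌋ = ⌊α + β⌋ - 1 := by
      rw [← add_sub_assoc, Int.floor_sub_one]
    have h' : MeroGerm.uPow 1 (-⌊α + (β - 1)⌋) ⊗ₜ[ℂ[X]] (1 : ℂ[X]) =
        MeroGerm.uPow 1 1 • (MeroGerm.uPow 1 (-⌊α + β⌋) ⊗ₜ[ℂ[X]] (1 : ℂ[X])) := by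
      rw [TensorProduct.smul_tmul', smul_eq_mul, ← MeroGerm.uPow_add, h]
      congr 2
      ring
    rw [h', Submodule.mem_span_singleton]
    constructor
    · rintro ⟨a, rfl⟩
      refine ⟨a • _, Submodule.smul_mem _ a (Submodule.subset_span rfl), ?_⟩
      rw [smul_comm]
    · rintro ⟨w, hw, rfl⟩
      obtain ⟨a, rfl⟩ := Submodule.mem_span_singleton.1 hw
      exact ⟨a, by rw [smul_comm]⟩

/-- A decomposition `ℰ = ⨁ᵢ ℒᵢ` of a filtered bundle as a direct sum of filtered bundles `ℒᵢ`,
with the filtration `𝒫_β ℰ = ⨁ᵢ 𝒫_β ℒᵢ`. -/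
structure FilteredBundle.Decomposition {K : ℕ} {ι : Type*} [Fintype ι] {r : ι → ℕ}
    (E : FilteredBundle K) (L : ∀ i, FilteredBundle (r i)) where
  incl : ∀ i, (L i).Sec →ₗ[ℂ[X]] E.Sec
  bijective : Function.Bijective fun s : (∀ i, (L i).Sec) => ∑ i, incl i (s i)
  mem_iff : ∀ β v, v ∈ E.P β ↔
    ∃ w : ∀ i, (L i).Germ, (∀ i, w i ∈ (L i).P β) ∧ v = ∑ i, germMap 1 (incl i) (w i)

/-- `ℰ` is a direct sum of filtered line bundles isomorphic to the `𝒪(αᵢ)`. -/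
def FilteredBundle.SplitsAs {K : ℕ} (E : FilteredBundle K) (α : Fin K → ℝ) : Prop :=
  ∃ L : Fin K → FilteredBundle.{0} 1,
    Nonempty (E.Decomposition L) ∧ ∀ i, Nonempty ((L i).Iso (lineBundle (α i)))

/-! ### Filtered `SL(K)`-Higgs bundles -/

/-- The `K`-fold wedge product of germs at `∞` of global sections, as a `ℂ[z]`-alternating map. -/
noncomputable def wedgeGerm (K : ℕ) (M : Type*) [AddCommGroup M] [Module ℂ[X] M] :
    M [⋀^Fin K]→ₗ[ℂ[X]] ⋀[MeroGerm 1]^K (GermModule 1 M) where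
  __ := ((exteriorPower.ιMulti (MeroGerm 1) (M := GermModule 1 M) K).toMultilinearMap.restrictScalars
    ℂ[X]).compLinearMap fun _ => TensorProduct.mk ℂ[X] (MeroGerm 1) M 1
  map_eq_zero_of_eq' := by
    intro s i j h hij
    exact (exteriorPower.ιMulti (MeroGerm 1) K).map_eq_zero_of_eq _ (by simp [h]) hij

/-- The germ at `∞` of a global section of `⋀ᴷ ℰ`. -/
noncomputable def exteriorGerm (K : ℕ) (M : Type*) [AddCommGroup M] [Module ℂ[X] M] :
    ⋀[ℂ[X]]^K M →ₗ[ℂ[X]] ⋀[MeroGerm 1]^K (GermModule 1 M) :=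
  exteriorPower.alternatingMapLinearEquiv (wedgeGerm K M)

/-- The filtration of the germ at `∞` of `⋀ᴷ ℰ`, induced by the filtration of `ℰ^{⊗K}`: it is
generated by the products `s₁ ∧ ⋯ ∧ s_K` with `sᵢ ∈ 𝒫_{βᵢ} ℰ` and `∑ βᵢ = α`. -/
noncomputable def FilteredBundle.exteriorP {K : ℕ} (E : FilteredBundle K) (α : ℝ) :
    Submodule (HoloGerm 1) (⋀[MeroGerm 1]^K E.Germ) :=
  Submodule.span (HoloGerm 1) {t | ∃ (β : Fin K → ℝ) (s : Fin K → E.Germ),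
    ∑ i, β i = α ∧ (∀ i, s i ∈ E.P (β i)) ∧ t = exteriorPower.ιMulti (MeroGerm 1) K s}

/-- A filtered `SL(K)`-bundle on `(ℂℙ¹, {∞})`: a filtered bundle with a global section `ω` of
`⋀ᴷ ℰ` that trivializes `⋀ᴷ ℰ` away from `∞` and has order `0` at `∞`. -/
structure FilteredSLBundle.{u} (K : ℕ) extends FilteredBundle.{u} K where
  ω : ⋀[ℂ[X]]^K Sec
  span_ω : Submodule.span ℂ[X] {ω} = ⊤
  order_ω : IsGLB {α : ℝ | exteriorGerm K Sec ω ∈ toFilteredBundle.exteriorP α} 0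

/-- A filtered `SL(K)`-Higgs bundle on `(ℂℙ¹, {∞})`. The Higgs field, a traceless section of
`End ℰ ⊗ K` that is holomorphic on `ℂ` and meromorphic at `∞`, is `φ dz`, where `φ` is an
endomorphism of the `ℂ[z]`-module of global sections of the `𝒪(*∞)`-module `ℰ`. -/
structure FilteredSLHiggsBundle.{u} (K : ℕ) extends FilteredSLBundle.{u} K where
  φ : Sec →ₗ[ℂ[X]] Sec
  trace_φ : LinearMap.trace ℂ[X] Sec φ = 0

/-! ### Goodness and the category `𝒞_{K,N}` -/

/-- The pullback of germs of sections to the `m`-fold cover. -/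
noncomputable def pullbackGerm (m : ℕ) [NeZero m] (M : Type*) [AddCommGroup M] [Module ℂ[X] M] :
    GermModule 1 M →ₗ[ℂ[X]] GermModule m M :=
  LinearMap.rTensor M (MeroGerm.pullback m).toLinearMap

/-- The natural filtration of the pullback of a filtered bundle to the `m`-fold cover: `𝒫_a` is
generated by the sections `u⁻ⁿ ψ^*s` with `s ∈ 𝒫_b` and `n + m b ≤ a`. -/
noncomputable def FilteredBundle.pullbackP {K : ℕ} (E : FilteredBundle K) (m : ℕ) [NeZero m]
    (a : ℝ) : Submodule (HoloGerm m) (GermModule m E.Sec) :=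
  Submodule.span (HoloGerm m) {v | ∃ (n : ℤ) (b : ℝ) (s : E.Germ),
    s ∈ E.P b ∧ (n : ℝ) + m * b ≤ a ∧ v = MeroGerm.uPow m (-n) • pullbackGerm m E.Sec s}

/-- The pullback `ψ^*(φ dz)` of the Higgs field to the `m`-fold cover, divided by `du`. -/
noncomputable def FilteredSLHiggsBundle.pullbackφ {K : ℕ} (E : FilteredSLHiggsBundle K) (m : ℕ) :
    GermModule m E.Sec →ₗ[MeroGerm m] GermModule m E.Sec :=
  MeroGerm.of m (deriv fun u : ℂ => u ^ (-(m : ℤ))) (meromorphicAt_zpow _).deriv • germMap m E.φ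

/-- A germ at `u = 0` of a filtered Higgs bundle, with underlying module `V`, filtration `P` and
Higgs field `φ du`, is *unramifiedly good* with singular type `(𝔞ᵢ)`, and the summands are line
bundles with the standard filtration by pole order: `V` is a direct sum of filtered line bundles
`Lᵢ`, the Higgs field preserves each `Lᵢ`, the difference `φ du - d𝔞ᵢ` is logarithmic on `Lᵢ`, and
`Lᵢ` has a generator `e` such that `P_a ∩ Lᵢ` consists of the sections `f e` where `f` has a pole
of order at most `a`. -/
def IsUnramifiedlyGoodStandard {m : ℕ} {V : Type*} [AddCommGroup V] [Module (MeroGerm m) V]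
    {ι : Type*} [Fintype ι] [DecidableEq ι]
    (P : ℝ → Submodule (HoloGerm m) V) (φ : V →ₗ[MeroGerm m] V)
    (𝔞 : ι → ℂ → ℂ) (h𝔞 : ∀ i, MeromorphicAt (𝔞 i) 0) : Prop :=
  ∃ L : ι → Submodule (MeroGerm m) V,
    DirectSum.IsInternal L ∧
    (∀ a v, v ∈ P a ↔ ∃ w : ι → V, (∀ i, w i ∈ L i ∧ w i ∈ P a) ∧ v = ∑ i, w i) ∧
    (∀ i, ∀ v ∈ L i, φ v ∈ L i) ∧
    (∀ i a, ∀ v ∈ L i, v ∈ P a →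
      φ v - MeroGerm.of m (deriv (𝔞 i)) (h𝔞 i).deriv • v ∈ P (a + 1)) ∧
    (∀ i, ∃ e, e ≠ 0 ∧ L i = Submodule.span (MeroGerm m) {e} ∧
      ∀ a v, (v ∈ L i ∧ v ∈ P a) ↔
        ∃ f ∈ HoloGerm m, v = (f * MeroGerm.uPow m (-⌊a⌋)) • e)

/-- The singular type `𝔞_r = K / (K + N) · exp(2πi r / K) · u ^ (-2 (N + K))`. -/
noncomputable def singularType (K N : ℕ) (r : Fin K) (u : ℂ) : ℂ :=
  (K : ℂ) / ((K : ℂ) + N) * Complex.exp (2 * Real.pi * Complex.I * ((r : ℕ) : ℂ) / K) *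
    u ^ (-(2 * ((N : ℤ) + K)))

theorem meromorphicAt_singularType (K N : ℕ) (r : Fin K) :
    MeromorphicAt (singularType K N r) 0 :=
  (MeromorphicAt.const _ 0).mul (meromorphicAt_zpow _)

/-- The objects of the category `𝒞_{K,N}`: filtered `SL(K)`-Higgs bundles on `(ℂℙ¹, {∞})` whose
pullback along `x = u^{2K}` is unramifiedly good, with the given singular type and with standard
filtrations on the line bundles. -/
structure CObj.{u} (K N : ℕ) [NeZero K] extends FilteredSLHiggsBundle.{u} K where
  good : IsUnramifiedlyGoodStandard (toFilteredBundle.pullbackP (2 * K))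
    (toFilteredSLHiggsBundle.pullbackφ (2 * K)) (singularType K N)
    (meromorphicAt_singularType K N)

/-- Existence of a morphism in `𝒞_{K,N}`, that is, of an isomorphism of filtered bundles that
preserves the Higgs fields. -/
def CObj.IsIso.{u} {K N : ℕ} [NeZero K] (E E' : CObj.{u} K N) : Prop :=
  ∃ f : E.toFilteredBundle.Iso E'.toFilteredBundle, ∀ s, f.equiv (E.φ s) = E'.φ (f.equiv s)

theorem CObj.isIso_equivalence.{u} (K N : ℕ) [NeZero K] :
    Equivalence (CObj.IsIso.{u} (K := K) (N := N)) where
  refl E := ⟨⟨LinearEquiv.refl _ _, fun α v => by simp [germMap, LinearMap.baseChange_id]⟩,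
    fun s => rfl⟩
  symm := by
    rintro E E' ⟨f, hf⟩
    refine ⟨⟨f.equiv.symm, fun α v => ?_⟩, fun s => ?_⟩
    · rw [f.mem_iff, ← LinearMap.comp_apply, ← LinearMap.baseChange_comp]
      simp [LinearMap.baseChange_id]
    · apply f.equiv.injective
      rw [hf]
      simp
  trans := by
    rintro E E' E'' ⟨f, hf⟩ ⟨g, hg⟩
    refine ⟨⟨f.equiv.trans g.equiv, fun α v => ?_⟩, fun s => ?_⟩
    · rw [f.mem_iff, g.mem_iff, ← LinearMap.comp_apply, ← LinearMap.baseChange_comp]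
      rfl
    · simp [hf, hg]

/-- The set `ℳ_{K,N}` of isomorphism classes of objects of `𝒞_{K,N}`. -/
def Moduli.{u} (K N : ℕ) [NeZero K] : Type (u + 1) :=
  Quotient ⟨CObj.IsIso.{u} (K := K) (N := N), CObj.isIso_equivalence.{u} K N⟩

/-- The isomorphism class of an object of `𝒞_{K,N}`. -/
def CObj.toModuli.{u} {K N : ℕ} [NeZero K] (E : CObj.{u} K N) : Moduli.{u} K N :=
  Quotient.mk _ E

/-! ### Cyclic partitions -/

/-- Ordered `K`-partitions of `N`. -/
def OrderedPartition (K N : ℕ) : Type := {b : Fin K → ℕ // ∑ i, b i = N}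

/-- Two ordered partitions are equivalent if they differ by a cyclic permutation of the index
set; addition in `Fin K` is modulo `K`. -/
def OrderedPartition.setoid (K N : ℕ) [NeZero K] : Setoid (OrderedPartition K N) where
  r b b' := ∃ c : Fin K, ∀ i, b'.1 i = b.1 (i + c)
  iseqv :=
    { refl := fun b => ⟨0, fun i => by rw [add_zero]⟩
      symm := by
        rintro b b' ⟨c, h⟩
        exact ⟨-c, fun i => by rw [h, neg_add_cancel_right]⟩
      trans := by
        rintro b b' b'' ⟨c, h⟩ ⟨d, h'⟩
        exact ⟨d + c, fun i => by rw [h', h, add_assoc]⟩ }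

/-- Cyclic `K`-partitions of `N`. -/
def CyclicPartition (K N : ℕ) [NeZero K] : Type := Quotient (OrderedPartition.setoid K N)

/-- The cyclic partition `[b]` of an ordered partition `b`. -/
def OrderedPartition.toCyclic {K N : ℕ} [NeZero K] (b : OrderedPartition K N) :
    CyclicPartition K N :=
  Quotient.mk _ b

/-- The relation `bᵢ - N / K = αᵢ - αᵢ₊₁`, with indices modulo `K`. -/
def IsDifference (K N : ℕ) [NeZero K] (α : Fin K → ℝ) (b : Fin K → ℤ) : Prop :=
  ∀ i, (b i : ℝ) - (N : ℝ) / K = α i - α (i + 1)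

/-- The cyclic partition `c` is attached to the object `E` by some splitting of the underlying
filtered bundle: `ℰ ≅ ⨁ 𝒪(αᵢ)`, `bᵢ - N / K = αᵢ - αᵢ₊₁` and `c = [b]`. -/
def CObj.HasShape.{u} {K N : ℕ} [NeZero K] (E : CObj.{u} K N) (c : CyclicPartition K N) : Prop :=
  ∃ (α : Fin K → ℝ) (b : OrderedPartition K N),
    E.SplitsAs α ∧ IsDifference K N α (fun i => (b.1 i : ℤ)) ∧ b.toCyclic = c

/-- The stratum `ℳ_{K,N}^{[b]}`: the classes of objects whose underlying filtered bundle has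
shape `[b]`. -/
def stratum.{u} (K N : ℕ) [NeZero K] (c : CyclicPartition K N) : Set (Moduli.{u} K N) :=
  {x | ∃ E : CObj.{u} K N, E.toModuli = x ∧ E.HasShape c}

universe u

/-! Splitting is the filtered Birkhoff–Grothendieck theorem, obtained from successive minima. Take
global sections `e₁, e₂, …`, each of least order `cᵢ` at `∞` among those outside the `ℂ({x})`-span
of its predecessors. Every germ at `∞` is a polynomial in `z` plus a germ vanishing at `∞`, so
correcting by polynomial combinations would produce a section of order below the minimum, unless the
`eᵢ` generate all global sections (`span_eq_top`) and `∑ fᵢ eᵢ` has order equal to the largest `pole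
fᵢ + cᵢ` (`orthogonal`).

Goodness enters only through `CObj.mem_pullbackP_iff`: on the cover, each eigenvalue of the Higgs
field divided by `dz` has a pole of order exactly `2N` in `u`, so `φ` raises every order by exactly
`N / K`. Computing the order of `φ eᵢ` in an adapted basis gives an index `j` and a natural number
`d` with `d = N / K + αⱼ - αᵢ` (`IsShiftClosed`).

The rest is arithmetic modulo `ℤ`. Passing from `i` to `j` lowers `α` by `N / K` modulo `ℤ`; since
`K` and `N` are coprime, `K` such steps visit `K` distinct classes, so the `αᵢ` are pairwise
incongruent and fill one coset of `K⁻¹ℤ / ℤ`. Hence an ordering with integral `bᵢ` exists and is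
forced up to rotation, and `bᵢ` is the natural number `d` found at `i + 1`. Two splittings of one
bundle are compared by the same computation with the identity in place of `φ`, which forces the same
numbers `αᵢ`. -/

/-! ### The order of a germ -/

namespace MeroGerm

variable {m : ℕ}

/-- The order of vanishing at `u = 0`. -/
noncomputable def ord (g : MeroGerm m) : WithTop ℤ :=
  meromorphicOrderAt (Classical.choose g.2) 0

theorem ord_of {f : ℂ → ℂ} (hf : MeromorphicAt f 0) :
    (of m f hf).ord = meromorphicOrderAt f 0 :=
  meromorphicOrderAt_congr (Germ.coe_eq.1 (Classical.choose_spec (of m f hf).2).2)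

theorem of_mul {f g : ℂ → ℂ} (hf : MeromorphicAt f 0) (hg : MeromorphicAt g 0) :
    of m f hf * of m g hg = of m (f * g) (hf.mul hg) := rfl

theorem of_add {f g : ℂ → ℂ} (hf : MeromorphicAt f 0) (hg : MeromorphicAt g 0) :
    of m f hf + of m g hg = of m (f + g) (hf.add hg) := rfl

theorem zero_eq_of : (0 : MeroGerm m) = of m (fun _ => 0) (MeromorphicAt.const 0 0) := rfl

theorem ord_eq_top_iff {g : MeroGerm m} : g.ord = ⊤ ↔ g = 0 := by
  obtain ⟨f, hf, rfl⟩ := of_surjective m g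
  rw [ord_of, meromorphicOrderAt_eq_top_iff, zero_eq_of, of_eq_of]
  rfl

theorem ord_mul (f g : MeroGerm m) : (f * g).ord = f.ord + g.ord := by
  obtain ⟨f, hf, rfl⟩ := of_surjective m f
  obtain ⟨g, hg, rfl⟩ := of_surjective m g
  rw [of_mul, ord_of, ord_of, ord_of, meromorphicOrderAt_mul hf hg]

theorem le_ord_add (f g : MeroGerm m) : min f.ord g.ord ≤ (f + g).ord := by
  obtain ⟨f, hf, rfl⟩ := of_surjective m f
  obtain ⟨g, hg, rfl⟩ := of_surjective m g
  rw [of_add, ord_of, ord_of, ord_of]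
  exact meromorphicOrderAt_add hf hg

theorem ord_uPow (n : ℤ) : (uPow m n).ord = n := by
  rw [uPow, ord_of]
  refine (meromorphicOrderAt_eq_int_iff (meromorphicAt_zpow n)).2
    ⟨fun _ => 1, analyticAt_const, one_ne_zero, Eventually.of_forall fun u => by simp⟩

theorem mem_holoGerm_iff {g : MeroGerm m} : g ∈ HoloGerm m ↔ 0 ≤ g.ord := by
  obtain ⟨f, hf, rfl⟩ := of_surjective m g
  rw [ord_of, hf.meromorphicOrderAt_nonneg_iff]
  constructor
  · rintro ⟨h, hh, he⟩
    exact ⟨h, hh, ((of_eq_of _ _).1 he).symm⟩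
  · rintro ⟨h, hh, he⟩
    exact ⟨h, hh, (of_eq_of _ _).2 he.symm⟩

/-- A nonzero germ has finite order, so it has no zeros on a small punctured disc and the pointwise
inverse works there. -/
theorem exists_mul_eq_one {g : MeroGerm m} (hg : g ≠ 0) : ∃ h, g * h = 1 := by
  obtain ⟨f, hf, rfl⟩ := of_surjective m g
  refine ⟨of m f⁻¹ hf.inv, ?_⟩
  have h1 : (1 : MeroGerm m) = of m (fun _ => 1) (MeromorphicAt.const 1 0) := rfl
  rw [of_mul, h1, of_eq_of]
  have h2 : meromorphicOrderAt f 0 ≠ ⊤ := by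
    rw [← ord_of (m := m) hf]
    exact fun h => hg (ord_eq_top_iff.1 h)
  filter_upwards [(meromorphicOrderAt_ne_top_iff_eventually_ne_zero hf).1 h2] with u hu
  simp [hu]

instance instNontrivial (m : ℕ) : Nontrivial (MeroGerm m) := by
  refine ⟨0, 1, fun h => ?_⟩
  have h1 : (0 : MeroGerm m).ord = ⊤ := ord_eq_top_iff.2 rfl
  rw [h, ← uPow_zero, ord_uPow] at h1
  exact WithTop.coe_ne_top h1

open Classical in
noncomputable instance instField (m : ℕ) : Field (MeroGerm m) where
  __ := instCommRing m
  inv g := if h : g = 0 then 0 else Classical.choose (exists_mul_eq_one h)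
  exists_pair_ne := exists_pair_ne _
  mul_inv_cancel g hg := by
    rw [dif_neg hg]
    exact Classical.choose_spec (exists_mul_eq_one hg)
  inv_zero := dif_pos rfl
  nnqsmul := _
  nnqsmul_def := fun _ _ => rfl
  qsmul := _
  qsmul_def := fun _ _ => rfl

/-! ### Pole orders and germs with bounded pole. -/

/-- The order of the pole at `u = 0`, with value `0` for the zero germ. -/
noncomputable def pole (g : MeroGerm m) : ℤ := -g.ord.untop₀

theorem ord_eq_pole {g : MeroGerm m} (hg : g ≠ 0) : g.ord = (-g.pole : ℤ) := by
  rw [pole, neg_neg, WithTop.coe_untop₀_of_ne_top (mt ord_eq_top_iff.1 hg)]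

theorem pole_eq {g : MeroGerm m} {n : ℤ} (h : g.ord = (-n : ℤ)) : g.pole = n := by
  rw [pole, h, WithTop.untop₀_coe, neg_neg]

theorem ne_zero_of_ord_eq {g : MeroGerm m} {n : ℤ} (h : g.ord = n) : g ≠ 0 := by
  rintro rfl
  rw [ord_eq_top_iff.2 rfl] at h
  exact WithTop.coe_ne_top h.symm

theorem pole_mul {f g : MeroGerm m} (hf : f ≠ 0) (hg : g ≠ 0) :
    (f * g).pole = f.pole + g.pole := by
  apply pole_eq
  rw [ord_mul, ord_eq_pole hf, ord_eq_pole hg, neg_add, WithTop.coe_add]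

theorem uPow_ne_zero (n : ℤ) : uPow m n ≠ 0 := ne_zero_of_ord_eq (ord_uPow n)

theorem pole_uPow (n : ℤ) : (uPow m n).pole = -n := pole_eq (by rw [ord_uPow, neg_neg])

theorem mem_holoGerm_iff_pole {g : MeroGerm m} : g ∈ HoloGerm m ↔ g = 0 ∨ g.pole ≤ 0 := by
  rw [mem_holoGerm_iff]
  by_cases hg : g = 0
  · simp [hg, ord_eq_top_iff.2]
  · rw [ord_eq_pole hg, ← WithTop.coe_zero, WithTop.coe_le_coe, Left.nonneg_neg_iff]
    simp [hg]

theorem pole_add_le {f g : MeroGerm m} (hf : f ≠ 0) (hg : g ≠ 0) (hfg : f + g ≠ 0) :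
    (f + g).pole ≤ max f.pole g.pole := by
  have h := le_ord_add f g
  rw [ord_eq_pole hf, ord_eq_pole hg, ord_eq_pole hfg, ← WithTop.coe_min, WithTop.coe_le_coe] at h
  omega

/-- The germs with a pole of order at most `t`. -/
noncomputable def poleLE (m : ℕ) (t : ℝ) : Submodule (HoloGerm m) (MeroGerm m) where
  -- `pole` sends `0` to `0`, so the zero germ must be admitted separately when `t < 0`.
  carrier := {g | g = 0 ∨ (g.pole : ℝ) ≤ t}
  zero_mem' := Or.inl rfl
  add_mem' := by
    intro f g hf hg
    by_cases hf0 : f = 0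
    · simpa [hf0] using hg
    by_cases hg0 : g = 0
    · simpa [hg0] using hf
    by_cases hfg : f + g = 0
    · exact Or.inl hfg
    refine Or.inr ?_
    have h : ((f + g).pole : ℝ) ≤ max (f.pole : ℝ) g.pole := by
      exact_mod_cast pole_add_le hf0 hg0 hfg
    exact h.trans (max_le (hf.resolve_left hf0) (hg.resolve_left hg0))
  smul_mem' := by
    rintro ⟨c, hc⟩ f hf
    by_cases hc0 : c = 0
    · exact Or.inl (by simp [Subring.smul_def, hc0])
    by_cases hf0 : f = 0
    · exact Or.inl (by simp [hf0])
    refine Or.inr ?_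
    rw [Subring.smul_def, smul_eq_mul, pole_mul hc0 hf0, Int.cast_add]
    have h1 := (mem_holoGerm_iff_pole.1 hc).resolve_left hc0
    have h2 : (c.pole : ℝ) ≤ 0 := by exact_mod_cast h1
    linarith [hf.resolve_left hf0]

theorem mem_poleLE {t : ℝ} {g : MeroGerm m} : g ∈ poleLE m t ↔ g = 0 ∨ (g.pole : ℝ) ≤ t := Iff.rfl

theorem poleLE_mono {s t : ℝ} (h : s ≤ t) : poleLE m s ≤ poleLE m t := by
  intro g hg
  exact hg.imp id fun h' => h'.trans h

theorem mem_holoGerm_iff_mem_poleLE {g : MeroGerm m} : g ∈ HoloGerm m ↔ g ∈ poleLE m 0 := by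
  rw [mem_holoGerm_iff_pole, mem_poleLE]
  norm_cast

theorem mem_poleLE_floor {t : ℝ} {g : MeroGerm m} : g ∈ poleLE m ⌊t⌋ ↔ g ∈ poleLE m t := by
  rw [mem_poleLE, mem_poleLE, Int.cast_le, Int.le_floor]

theorem mul_mem_poleLE_iff {f g : MeroGerm m} {t : ℝ} (hf : f ≠ 0) :
    f * g ∈ poleLE m t ↔ g ∈ poleLE m (t - f.pole) := by
  by_cases hg : g = 0
  · simp [hg]
  · rw [mem_poleLE, mem_poleLE, pole_mul hf hg, Int.cast_add, le_sub_iff_add_le']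
    simp [hf, hg]

theorem mul_mem_poleLE {f g : MeroGerm m} {s t : ℝ} (hf : f ∈ poleLE m s) (hg : g ∈ poleLE m t) :
    f * g ∈ poleLE m (s + t) := by
  by_cases hf0 : f = 0
  · simp [hf0]
  rw [mul_mem_poleLE_iff hf0]
  exact poleLE_mono (by linarith [hf.resolve_left hf0]) hg

theorem uPow_mem_poleLE {n : ℤ} {t : ℝ} : uPow m n ∈ poleLE m t ↔ -(n : ℝ) ≤ t := by
  rw [mem_poleLE, pole_uPow, Int.cast_neg]
  simp [uPow_ne_zero]

/-- Bridge to the floor form in which `lineBundle` and `IsUnramifiedlyGoodStandard` express their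
filtrations. -/
theorem mem_poleLE_iff_exists {t : ℝ} {g : MeroGerm m} :
    g ∈ poleLE m t ↔ ∃ f ∈ HoloGerm m, g = f * uPow m (-⌊t⌋) := by
  constructor
  · intro h
    refine ⟨g * uPow m ⌊t⌋, ?_, ?_⟩
    · rw [mem_holoGerm_iff_mem_poleLE]
      convert mul_mem_poleLE (mem_poleLE_floor.2 h) (uPow_mem_poleLE.2 le_rfl) using 2
      ring
    · rw [mul_assoc, ← uPow_add, add_neg_cancel, uPow_zero, mul_one]
  · rintro ⟨f, hf, rfl⟩
    rw [← mem_poleLE_floor]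
    convert mul_mem_poleLE (mem_holoGerm_iff_mem_poleLE.1 hf) (uPow_mem_poleLE.2 le_rfl) using 2
    simp

/-- From `(-1) * (-1) = 1`, the pole order of `-1` is `0`. -/
theorem pole_neg (g : MeroGerm m) : (-g).pole = g.pole := by
  by_cases hg : g = 0
  · simp [hg]
  have h1 : (-1 : MeroGerm m) ≠ 0 := neg_ne_zero.2 one_ne_zero
  have h2 := pole_mul h1 h1
  have h3 := pole_uPow (m := m) 0
  rw [uPow_zero] at h3
  rw [neg_mul_neg, one_mul, h3] at h2
  rw [← neg_one_mul, pole_mul h1 hg]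
  omega

theorem pole_add_eq_of_mem {f g : MeroGerm m} {t : ℝ} (hf : f ≠ 0) (hg : g ∈ poleLE m t)
    (h : t < f.pole) : f + g ≠ 0 ∧ (f + g).pole = f.pole := by
  have hne : f + g ≠ 0 := by
    intro h0
    have hg' : -f ∈ poleLE m t := by rwa [← eq_neg_of_add_eq_zero_right h0]
    have := hg'.resolve_left (neg_ne_zero.2 hf)
    rw [pole_neg] at this
    linarith
  refine ⟨hne, ?_⟩
  by_cases hg0 : g = 0
  · simp [hg0]
  have hlt : g.pole < f.pole := by
    have := hg.resolve_left hg0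
    exact_mod_cast this.trans_lt h
  apply le_antisymm
  · exact (pole_add_le hf hg0 hne).trans (max_le le_rfl hlt.le)
  -- In `f = (f + g) + (-g)` the term `-g` is too small to account for the pole of `f`.
  · have h3 : f + g + -g ≠ 0 := by rwa [add_neg_cancel_right]
    have h4 := pole_add_le hne (neg_ne_zero.2 hg0) h3
    rw [add_neg_cancel_right, pole_neg] at h4
    omega

/-! #### Pullback and polynomials -/

theorem ord_pullback [NeZero m] (g : MeroGerm 1) : (pullback m g).ord = g.ord * (m : ℤ) := by
  obtain ⟨f, hf, rfl⟩ := of_surjective 1 g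
  have hm : m ≠ 0 := NeZero.ne m
  have hg : AnalyticAt ℂ (fun u : ℂ => u ^ m) 0 := by fun_prop
  have hf' : MeromorphicAt f ((fun u : ℂ => u ^ m) 0) := by simpa [hm] using hf
  have h : pullback m (of 1 f hf) = of m (f ∘ fun u : ℂ => u ^ m) (hf'.comp_analyticAt (g := fun u : ℂ => u ^ m) hg) := rfl
  have hord : analyticOrderAt (fun u : ℂ => u ^ m - 0 ^ m) 0 = (m : ℕ∞) := by
    refine (AnalyticAt.analyticOrderAt_eq_natCast (by fun_prop)).2
      ⟨fun _ => 1, analyticAt_const, one_ne_zero, Eventually.of_forall fun u => ?_⟩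
    simp [hm]
  have hnc : ¬ EventuallyConst (fun u : ℂ => u ^ m) (𝓝 0) := by
    rw [eventuallyConst_iff_analyticOrderAt_sub_eq_top, hord]
    exact ENat.natCast_ne_top m
  rw [h, ord_of, ord_of, MeromorphicAt.meromorphicOrderAt_comp (g := fun u : ℂ => u ^ m) hf' hg hnc, hord]
  simp [hm]

theorem pole_pullback [NeZero m] (g : MeroGerm 1) : (pullback m g).pole = m * g.pole := by
  by_cases hg : g = 0
  · simp [hg, pole, ord_eq_top_iff.2]
  apply pole_eq
  rw [ord_pullback, ord_eq_pole hg, ← WithTop.coe_mul]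
  congr 1
  ring

theorem pullback_mem_poleLE [NeZero m] {g : MeroGerm 1} {t : ℝ} (hg : g ∈ poleLE 1 t) :
    pullback m g ∈ poleLE m (m * t) := by
  rcases hg with rfl | hg
  · simp
  · refine Or.inr ?_
    rw [pole_pullback]
    push_cast
    gcongr

theorem algebraMap_C (c : ℂ) :
    algebraMap ℂ[X] (MeroGerm m) (C c) = of m (fun _ => c) (MeromorphicAt.const c 0) :=
  Polynomial.eval₂_C _ _

theorem algebraMap_X : algebraMap ℂ[X] (MeroGerm m) X = uPow m (-(m : ℤ)) :=
  Polynomial.eval₂_X _ _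

theorem pole_C {c : ℂ} (hc : c ≠ 0) : algebraMap ℂ[X] (MeroGerm m) (C c) ≠ 0 ∧
    (algebraMap ℂ[X] (MeroGerm m) (C c)).pole = 0 := by
  have h : (algebraMap ℂ[X] (MeroGerm m) (C c)).ord = ((-0 : ℤ) : WithTop ℤ) := by
    classical
    rw [algebraMap_C, ord_of, meromorphicOrderAt_const, if_neg hc]
    rfl
  exact ⟨ne_zero_of_ord_eq h, pole_eq h⟩

theorem C_mem_holoGerm (c : ℂ) : algebraMap ℂ[X] (MeroGerm m) (C c) ∈ HoloGerm m :=
  ⟨fun _ => c, analyticAt_const, (algebraMap_C c).symm⟩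

theorem pole_X_pow (n : ℕ) : (algebraMap ℂ[X] (MeroGerm m) (X ^ n)).pole = m * n := by
  induction n with
  | zero => simpa [uPow_zero] using pole_uPow (m := m) 0
  | succ n ih =>
    have h : algebraMap ℂ[X] (MeroGerm m) X ≠ 0 := by
      rw [algebraMap_X]; exact uPow_ne_zero _
    rw [pow_succ, map_mul, pole_mul (by rw [map_pow]; exact pow_ne_zero n h) h, ih, algebraMap_X,
      pole_uPow]
    push_cast
    ring

/-- Induction on the degree `n`: the leading term has a pole of order `m n`, the rest of order at
most `m (n - 1) ≤ m n - 1`, so nothing cancels. -/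
theorem pole_algebraMap [NeZero m] (p : ℂ[X]) (hp : p ≠ 0) :
    algebraMap ℂ[X] (MeroGerm m) p ≠ 0 ∧
      (algebraMap ℂ[X] (MeroGerm m) p).pole = m * p.natDegree := by
  have hm : 0 < m := NeZero.pos m
  have key : ∀ n : ℕ, ∀ p : ℂ[X], p ≠ 0 → p.natDegree = n →
      algebraMap ℂ[X] (MeroGerm m) p ≠ 0 ∧ (algebraMap ℂ[X] (MeroGerm m) p).pole = m * n := by
    intro n
    induction n using Nat.strong_induction_on with
    | _ n ih =>
      intro p hp hn
      have hX : algebraMap ℂ[X] (MeroGerm m) (X ^ n) ≠ 0 := by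
        rw [map_pow, algebraMap_X]; exact pow_ne_zero n (uPow_ne_zero _)
      have hc := pole_C (m := m) (leadingCoeff_ne_zero.2 hp)
      have hlead : algebraMap ℂ[X] (MeroGerm m) (C p.leadingCoeff * X ^ n) ≠ 0 := by
        rw [map_mul]; exact mul_ne_zero hc.1 hX
      have hpole : (algebraMap ℂ[X] (MeroGerm m) (C p.leadingCoeff * X ^ n)).pole = m * n := by
        rw [map_mul, pole_mul hc.1 hX, hc.2, pole_X_pow, zero_add]
      have hsplit : p = C p.leadingCoeff * X ^ n + p.eraseLead := by
        rw [← hn, add_comm, eraseLead_add_C_mul_X_pow]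
      have hrest : algebraMap ℂ[X] (MeroGerm m) p.eraseLead ∈ poleLE m (m * n - 1) := by
        by_cases h0 : p.eraseLead = 0
        · simp [h0]
        have hlt : p.eraseLead.natDegree < n := by
          rcases p.eraseLead_natDegree_lt_or_eraseLead_eq_zero with h | h
          · rwa [hn] at h
          · exact absurd h h0
        refine Or.inr ?_
        rw [(ih _ hlt _ h0 rfl).2]
        have : ((p.eraseLead.natDegree : ℝ)) + 1 ≤ n := by exact_mod_cast hlt
        have hm' : (1 : ℝ) ≤ m := by exact_mod_cast hm
        push_cast
        nlinarith
      have := pole_add_eq_of_mem hlead hrest (by rw [hpole]; push_cast; linarith)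
      rw [← map_add, ← hsplit] at this
      exact ⟨this.1, this.2.trans hpole⟩
  exact key _ p hp rfl

theorem algebraMap_injective [NeZero m] : Function.Injective (algebraMap ℂ[X] (MeroGerm m)) :=
  (injective_iff_map_eq_zero _).2 fun p hp => by
    by_contra h
    exact (pole_algebraMap p h).1 hp

instance [NeZero m] : FaithfulSMul ℂ[X] (MeroGerm m) :=
  (faithfulSMul_iff_algebraMap_injective _ _).2 algebraMap_injective

/-- The constant is the value at `0` of a holomorphic representative. -/
theorem exists_sub_C_mem {g : MeroGerm m} (hg : g ∈ poleLE m 0) :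
    ∃ c : ℂ, g - algebraMap ℂ[X] (MeroGerm m) (C c) ∈ poleLE m (-1) := by
  obtain ⟨f, hf, rfl⟩ := mem_holoGerm_iff_mem_poleLE.2 hg
  refine ⟨f 0, ?_⟩
  have ha : AnalyticAt ℂ (fun u => f u + -f 0) 0 := by fun_prop
  have h : of m f hf.meromorphicAt - algebraMap ℂ[X] (MeroGerm m) (C (f 0)) =
      of m (fun u => f u + -f 0) ha.meromorphicAt := by
    rw [sub_eq_iff_eq_add, algebraMap_C, of_add, of_eq_of]
    exact Eventually.of_forall fun u => by simp
  rw [h]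
  by_cases h0 : of m (fun u => f u + -f 0) ha.meromorphicAt = 0
  · exact Or.inl h0
  refine Or.inr ?_
  have h1 : analyticOrderAt (fun u => f u + -f 0) 0 ≠ 0 := by
    rw [Ne, analyticOrderAt_eq_zero]
    simp [ha]
  have h2 := ord_eq_pole h0
  rw [ord_of, ha.meromorphicOrderAt_eq] at h2
  cases hn : analyticOrderAt (fun u => f u + -f 0) 0 with
  | top => rw [hn] at h2; exact absurd h2.symm WithTop.coe_ne_top
  | coe n =>
    rw [hn, ENat.map_natCast, WithTop.coe_inj] at h2
    have h3 : n ≠ 0 := by rintro rfl; exact h1 (by rw [hn]; rfl)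
    have : (of m (fun u => f u + -f 0) ha.meromorphicAt).pole ≤ -1 := by omega
    exact_mod_cast this

/-- A germ at `∞` is the sum of a polynomial in `z` and a germ that vanishes at `∞`. -/
theorem exists_sub_algebraMap_mem (g : MeroGerm 1) :
    ∃ p : ℂ[X], g - algebraMap ℂ[X] (MeroGerm 1) p ∈ poleLE 1 (-1) := by
  have key : ∀ n : ℕ, ∀ g ∈ poleLE 1 (n : ℝ),
      ∃ p : ℂ[X], g - algebraMap ℂ[X] (MeroGerm 1) p ∈ poleLE 1 (-1) := by
    intro n
    induction n with
    | zero =>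
      intro g hg
      obtain ⟨c, hc⟩ := exists_sub_C_mem (by simpa using hg)
      exact ⟨C c, hc⟩
    | succ n ih =>
      intro g hg
      have hX : algebraMap ℂ[X] (MeroGerm 1) (X ^ (n + 1)) ≠ 0 := by
        rw [map_pow, algebraMap_X]; exact pow_ne_zero _ (uPow_ne_zero _)
      have hXp := pole_X_pow (m := 1) (n + 1)
      -- The cofactor `h` of `z ^ (n + 1)` is holomorphic. Subtracting its value at `∞` removes the
      -- leading term of `g` and leaves a pole of order at most `n`.
      obtain ⟨h, rfl⟩ : ∃ h, g = algebraMap ℂ[X] (MeroGerm 1) (X ^ (n + 1)) * h :=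
        ⟨_, (mul_inv_cancel_left₀ hX g).symm⟩
      rw [mul_mem_poleLE_iff hX, hXp] at hg
      obtain ⟨c, hc⟩ := exists_sub_C_mem (poleLE_mono (by push_cast; simp) hg)
      obtain ⟨p, hp⟩ := ih (algebraMap ℂ[X] (MeroGerm 1) (X ^ (n + 1)) *
          (h - algebraMap ℂ[X] (MeroGerm 1) (C c))) (by
        rw [mul_mem_poleLE_iff hX, hXp]
        exact poleLE_mono (by push_cast; simp) hc)
      refine ⟨X ^ (n + 1) * C c + p, ?_⟩
      convert hp using 1
      rw [map_add, map_mul]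
      ring
  obtain ⟨n, hn⟩ := exists_nat_ge (g.pole : ℝ)
  exact key n g (Or.inr hn)

end MeroGerm

/-! ### Splittings as adapted bases -/

theorem lineBundle_mem_P {α β : ℝ} {v : (lineBundle α).Germ} :
    v ∈ (lineBundle α).P β ↔
      AlgebraTensorModule.rid ℂ[X] (MeroGerm 1) (MeroGerm 1) v ∈ MeroGerm.poleLE 1 (β + α) := by
  obtain ⟨g, rfl⟩ : ∃ g : MeroGerm 1, g ⊗ₜ[ℂ[X]] (1 : ℂ[X]) = v :=
    ⟨_, (AlgebraTensorModule.rid ℂ[X] (MeroGerm 1) (MeroGerm 1)).symm_apply_apply v⟩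
  have h : g ⊗ₜ[ℂ[X]] (1 : ℂ[X]) ∈ (lineBundle α).P β ↔
      ∃ a : HoloGerm 1, a • (MeroGerm.uPow 1 (-⌊α + β⌋) ⊗ₜ[ℂ[X]] (1 : ℂ[X])) =
        g ⊗ₜ[ℂ[X]] (1 : ℂ[X]) := Submodule.mem_span_singleton
  refine h.trans ?_
  have h' : AlgebraTensorModule.rid ℂ[X] (MeroGerm 1) (MeroGerm 1) (g ⊗ₜ[ℂ[X]] (1 : ℂ[X])) = g := by
    rw [AlgebraTensorModule.rid_tmul, one_smul]
  refine Iff.trans ?_ (iff_of_eq (congrArg (· ∈ MeroGerm.poleLE 1 (β + α)) h'.symm))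
  rw [MeroGerm.mem_poleLE_iff_exists, add_comm β α]
  constructor
  · rintro ⟨a, ha⟩
    refine ⟨a, a.2, ?_⟩
    have := congrArg (AlgebraTensorModule.rid ℂ[X] (MeroGerm 1) (MeroGerm 1)) ha
    rw [TensorProduct.smul_tmul', AlgebraTensorModule.rid_tmul, AlgebraTensorModule.rid_tmul,
      one_smul, one_smul] at this
    exact this.symm
  · rintro ⟨f, hf, rfl⟩
    exact ⟨⟨f, hf⟩, by rw [TensorProduct.smul_tmul']; rfl⟩

namespace FilteredBundle

/-- The `ℂ[z]`-basis `e` of the global sections splits the filtration, where `eᵢ` has order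
`cᵢ` at `∞`. -/
def IsSplitting {K : ℕ} (E : FilteredBundle K) {ι : Type*} (e : Module.Basis ι ℂ[X] E.Sec)
    (c : ι → ℝ) : Prop :=
  ∀ β v, v ∈ E.P β ↔ ∀ i, (e.baseChange (MeroGerm 1)).repr v i ∈ MeroGerm.poleLE 1 (β - c i)

theorem germMap_toSpanSingleton {M : Type*} [AddCommGroup M] [Module ℂ[X] M] (s : M)
    (w : GermModule 1 ℂ[X]) :
    germMap 1 (LinearMap.toSpanSingleton ℂ[X] M s) w =
      AlgebraTensorModule.rid ℂ[X] (MeroGerm 1) (MeroGerm 1) w • ((1 : MeroGerm 1) ⊗ₜ[ℂ[X]] s) := by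
  induction w using TensorProduct.induction_on with
  | zero => simp
  | add v w hv hw => rw [map_add, hv, hw, map_add, add_smul]
  | tmul f p =>
    rw [AlgebraTensorModule.rid_tmul, germMap, LinearMap.baseChange_tmul,
      LinearMap.toSpanSingleton_apply, TensorProduct.smul_tmul', smul_eq_mul, mul_one,
      TensorProduct.smul_tmul]

/-- The generator `1` of `𝒪(α)` lies in `𝒫_β` exactly when `α + β ≥ 0`, so its order is `-α`; hence
the sign. From here on, questions about the filtration are bounds on the poles of coordinates. -/
theorem exists_isSplitting_of_decomposition {K : ℕ} {ι : Type*} [Fintype ι] (E : FilteredBundle K)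
    (α : ι → ℝ) (D : E.Decomposition fun i => lineBundle (α i)) :
    ∃ e : Module.Basis ι ℂ[X] E.Sec, E.IsSplitting e fun i => -α i := by
  classical
  let D' : ∀ i, ℂ[X] →ₗ[ℂ[X]] E.Sec := D.incl
  let f : (ι → ℂ[X]) →ₗ[ℂ[X]] E.Sec := ∑ i, D' i ∘ₗ LinearMap.proj i
  have hf : ∀ s, f s = ∑ i, D' i (s i) := fun s => by simp [f]
  have hbij : Function.Bijective f := by
    rw [show ⇑f = fun s => ∑ i, D' i (s i) from _root_.funext hf]
    exact D.bijective
  let e : Module.Basis ι ℂ[X] E.Sec :=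
    Module.Basis.ofEquivFun (LinearEquiv.ofBijective f hbij).symm
  have he : ∀ i, e i = D' i 1 := by
    intro i
    rw [Module.Basis.coe_ofEquivFun]
    simp only [LinearEquiv.symm_symm, LinearEquiv.ofBijective_apply, hf]
    rw [Finset.sum_eq_single i]
    · simp
    · intro j _ hj
      simp [hj]
    · simp
  have hD : ∀ i, D' i = LinearMap.toSpanSingleton ℂ[X] E.Sec (e i) := by
    intro i
    ext
    simp [he]
  have hsum : ∀ w : ι → GermModule 1 ℂ[X], ∑ i, germMap 1 (D' i) (w i) =
      (e.baseChange (MeroGerm 1)).equivFun.symm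
        fun i => AlgebraTensorModule.rid ℂ[X] (MeroGerm 1) (MeroGerm 1) (w i) := by
    intro w
    rw [Module.Basis.equivFun_symm_apply]
    refine Finset.sum_congr rfl fun i _ => ?_
    rw [hD, germMap_toSpanSingleton, Module.Basis.baseChange_apply]
  refine ⟨e, fun β v => (D.mem_iff β v).trans ?_⟩
  constructor
  · rintro ⟨w, hw, hv⟩ i
    rw [hv, sub_neg_eq_add]
    have h := lineBundle_mem_P.1 (hw i)
    have h2 := hsum w
    rw [← Module.Basis.equivFun_apply]
    erw [h2]
    rwa [LinearEquiv.apply_symm_apply]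
  · intro h
    refine ⟨fun i => (AlgebraTensorModule.rid ℂ[X] (MeroGerm 1) (MeroGerm 1)).symm
      ((e.baseChange (MeroGerm 1)).repr v i), fun i => ?_, ?_⟩
    · apply lineBundle_mem_P.2
      rw [LinearEquiv.apply_symm_apply, ← sub_neg_eq_add]
      exact h i
    · refine Eq.trans ?_ (hsum _).symm
      simp only [LinearEquiv.apply_symm_apply]
      exact ((e.baseChange (MeroGerm 1)).equivFun.symm_apply_apply v).symm

/-- Replace the summands of a decomposition by isomorphic ones. -/
noncomputable def Decomposition.congr {K : ℕ} {ι : Type*} [Fintype ι] {r : ι → ℕ}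
    {E : FilteredBundle K} {L L' : ∀ i, FilteredBundle (r i)} (D : E.Decomposition L)
    (f : ∀ i, (L i).Iso (L' i)) : E.Decomposition L' where
  incl i := D.incl i ∘ₗ ((f i).equiv.symm : (L' i).Sec →ₗ[ℂ[X]] (L i).Sec)
  bijective := D.bijective.comp (Equiv.piCongrRight fun i => (f i).equiv.symm.toEquiv).bijective
  mem_iff β v := by
    rw [D.mem_iff]
    have h1 : ∀ i (x : (L i).Germ), germMap 1 ((f i).equiv.symm : (L' i).Sec →ₗ[ℂ[X]] (L i).Sec)
        (germMap 1 ((f i).equiv : (L i).Sec →ₗ[ℂ[X]] (L' i).Sec) x) = x := by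
      intro i x
      rw [← LinearMap.comp_apply, ← LinearMap.baseChange_comp]
      simp [LinearMap.baseChange_id]
    have h2 : ∀ i (x : (L' i).Germ), germMap 1 ((f i).equiv : (L i).Sec →ₗ[ℂ[X]] (L' i).Sec)
        (germMap 1 ((f i).equiv.symm : (L' i).Sec →ₗ[ℂ[X]] (L i).Sec) x) = x := by
      intro i x
      rw [← LinearMap.comp_apply, ← LinearMap.baseChange_comp]
      simp [LinearMap.baseChange_id]
    constructor
    · rintro ⟨w, hw, rfl⟩
      refine ⟨fun i => germMap 1 ((f i).equiv : (L i).Sec →ₗ[ℂ[X]] (L' i).Sec) (w i),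
        fun i => ((f i).mem_iff β _).1 (hw i), Finset.sum_congr rfl fun i _ => ?_⟩
      beta_reduce
      rw [germMap, germMap, LinearMap.baseChange_comp, LinearMap.comp_apply]
      exact congrArg _ (h1 i (w i)).symm
    · rintro ⟨w, hw, rfl⟩
      refine ⟨fun i => germMap 1 ((f i).equiv.symm : (L' i).Sec →ₗ[ℂ[X]] (L i).Sec) (w i),
        fun i => ((f i).mem_iff β _).2 (by rw [h2]; exact hw i), Finset.sum_congr rfl fun i _ => ?_⟩
      rw [germMap, LinearMap.baseChange_comp, LinearMap.comp_apply]

/-- The identity isomorphism. -/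
noncomputable def Iso.refl {K : ℕ} (E : FilteredBundle K) : E.Iso E :=
  ⟨LinearEquiv.refl _ _, fun α v => by simp [germMap, LinearMap.baseChange_id]⟩

theorem SplitsAs.exists_isSplitting {K : ℕ} {E : FilteredBundle K} {α : Fin K → ℝ}
    (h : E.SplitsAs α) :
    ∃ e : Module.Basis (Fin K) ℂ[X] E.Sec, E.IsSplitting e fun i => -α i := by
  obtain ⟨L, ⟨D⟩, f⟩ := h
  exact E.exists_isSplitting_of_decomposition α (D.congr fun i => (f i).some)

theorem IsSplitting.splitsAs {K : ℕ} {E : FilteredBundle K} {α : Fin K → ℝ}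
    {e : Module.Basis (Fin K) ℂ[X] E.Sec} (h : E.IsSplitting e fun i => -α i) :
    E.SplitsAs α := by
  refine ⟨fun i => lineBundle (α i), ⟨?_⟩, fun i => ⟨Iso.refl _⟩⟩
  have hsum : ∀ w : Fin K → GermModule 1 ℂ[X],
      ∑ i, germMap 1 (LinearMap.toSpanSingleton ℂ[X] E.Sec (e i)) (w i) =
      (e.baseChange (MeroGerm 1)).equivFun.symm
        fun i => AlgebraTensorModule.rid ℂ[X] (MeroGerm 1) (MeroGerm 1) (w i) := by
    intro w
    rw [Module.Basis.equivFun_symm_apply]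
    refine Finset.sum_congr rfl fun i _ => ?_
    rw [germMap_toSpanSingleton, Module.Basis.baseChange_apply]
  refine ⟨fun i => LinearMap.toSpanSingleton ℂ[X] E.Sec (e i), ?_, fun β v => ?_⟩
  · have h : (fun s : Fin K → ℂ[X] => ∑ i, LinearMap.toSpanSingleton ℂ[X] E.Sec (e i) (s i)) =
        e.equivFun.symm := by
      funext s
      exact (e.equivFun_symm_apply _).symm
    have hb := e.equivFun.symm.bijective
    rw [← h] at hb
    exact hb
  · rw [h β v]
    constructor
    · intro h
      refine ⟨fun i => (AlgebraTensorModule.rid ℂ[X] (MeroGerm 1) (MeroGerm 1)).symm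
        ((e.baseChange (MeroGerm 1)).repr v i), fun i => ?_, ?_⟩
      · apply lineBundle_mem_P.2
        rw [LinearEquiv.apply_symm_apply, ← sub_neg_eq_add]
        exact h i
      · refine Eq.trans ?_ (hsum _).symm
        simp only [LinearEquiv.apply_symm_apply]
        exact ((e.baseChange (MeroGerm 1)).equivFun.symm_apply_apply v).symm
    · rintro ⟨w, hw, hv⟩ i
      rw [hv, sub_neg_eq_add]
      have h := lineBundle_mem_P.1 (hw i)
      have h2 := hsum w
      rw [← Module.Basis.equivFun_apply]
      erw [h2]
      rwa [LinearEquiv.apply_symm_apply]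

/-- Splittings are invariant under isomorphism. -/
theorem SplitsAs.of_iso {K : ℕ} {E E' : FilteredBundle K} {α : Fin K → ℝ}
    (h : E.SplitsAs α) (f : E.Iso E') : E'.SplitsAs α := by
  obtain ⟨L, ⟨D⟩, hL⟩ := h
  refine ⟨L, ⟨⟨fun i => (f.equiv : E.Sec →ₗ[ℂ[X]] E'.Sec) ∘ₗ D.incl i, ?_, fun β v => ?_⟩⟩, hL⟩
  · convert f.equiv.bijective.comp D.bijective using 1
    funext s
    simp
  · have h1 : germMap 1 (f.equiv : E.Sec →ₗ[ℂ[X]] E'.Sec)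
        (germMap 1 (f.equiv.symm : E'.Sec →ₗ[ℂ[X]] E.Sec) v) = v := by
      rw [← LinearMap.comp_apply, ← LinearMap.baseChange_comp]
      simp [LinearMap.baseChange_id]
    have h2 : ∀ x, germMap 1 (f.equiv.symm : E'.Sec →ₗ[ℂ[X]] E.Sec)
        (germMap 1 (f.equiv : E.Sec →ₗ[ℂ[X]] E'.Sec) x) = x := by
      intro x
      rw [← LinearMap.comp_apply, ← LinearMap.baseChange_comp]
      simp [LinearMap.baseChange_id]
    have h3 : v ∈ E'.P β ↔ germMap 1 (f.equiv.symm : E'.Sec →ₗ[ℂ[X]] E.Sec) v ∈ E.P β := by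
      rw [f.mem_iff, h1]
    have h4 : ∀ w : ∀ i, (L i).Germ,
        ∑ i, germMap 1 ((f.equiv : E.Sec →ₗ[ℂ[X]] E'.Sec) ∘ₗ D.incl i) (w i) =
          germMap 1 (f.equiv : E.Sec →ₗ[ℂ[X]] E'.Sec) (∑ i, germMap 1 (D.incl i) (w i)) := by
      intro w
      rw [map_sum]
      exact Finset.sum_congr rfl fun i _ => by
        rw [germMap, LinearMap.baseChange_comp, LinearMap.comp_apply]
    rw [h3, D.mem_iff]
    refine exists_congr fun w => and_congr Iff.rfl ?_
    rw [h4]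
    constructor
    · intro h
      rw [← h, h1]
    · rintro rfl
      rw [h2]

end FilteredBundle

/-! ### Existence of splittings -/

theorem holoGerm_smul_def {m : ℕ} {M : Type*} [AddCommGroup M] [Module ℂ[X] M] (f : HoloGerm m)
    (v : GermModule m M) : f • v = (f : MeroGerm m) • v := rfl

theorem germ_sub_smul {m : ℕ} {M : Type*} [AddCommGroup M] [Module ℂ[X] M] (f g : MeroGerm m)
    (v : GermModule m M) : (f - g) • v = f • v - g • v := sub_smul f g v

namespace FilteredBundle

variable {K : ℕ} (E : FilteredBundle K)

theorem uPow_smul_mem_P_iff (n : ℤ) : ∀ (β : ℝ) (v : E.Germ),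
    MeroGerm.uPow 1 n • v ∈ E.P (β - n) ↔ v ∈ E.P β := by
  have key : ∀ β v, MeroGerm.uPow 1 1 • v ∈ E.P (β - 1) ↔ v ∈ E.P β := by
    intro β v
    rw [E.shift]
    constructor
    · rintro ⟨w, hw, h⟩
      rwa [smul_right_injective E.Germ (MeroGerm.uPow_ne_zero 1) h]
    · exact fun h => ⟨v, h, rfl⟩
  induction n using Int.induction_on with
  | zero => intro β v; simp [MeroGerm.uPow_zero]
  | succ n ih =>
    intro β v
    rw [add_comm (n : ℤ) 1, MeroGerm.uPow_add, mul_smul]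
    have h : β - ((1 + (n : ℤ) : ℤ) : ℝ) = β - ((n : ℤ) : ℝ) - 1 := by push_cast; ring
    rw [h, key, ih]
  | pred n ih =>
    intro β v
    have h1 := ih (β) v
    have h : MeroGerm.uPow 1 (-(n : ℤ)) • v =
        MeroGerm.uPow 1 1 • (MeroGerm.uPow 1 (-(n : ℤ) - 1) • v) := by
      rw [← mul_smul, ← MeroGerm.uPow_add]
      congr 2
      ring
    rw [h] at h1
    rw [← h1, ← key]
    have h2 : β - ((-(n : ℤ) - 1 : ℤ) : ℝ) - 1 = β - ((-(n : ℤ) : ℤ) : ℝ) := by push_cast; ring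
    rw [h2]

theorem smul_mem_P {f : MeroGerm 1} {t β : ℝ} {v : E.Germ} (hf : f ∈ MeroGerm.poleLE 1 t)
    (hv : v ∈ E.P β) : f • v ∈ E.P (β + t) := by
  obtain ⟨g, hg, rfl⟩ := MeroGerm.mem_poleLE_iff_exists.1 hf
  rw [mul_smul]
  refine (E.P _).smul_mem (⟨g, hg⟩ : HoloGerm 1) (E.mono ?_ ((E.uPow_smul_mem_P_iff (-⌊t⌋) β v).2 hv))
  push_cast
  linarith [Int.floor_le t]

theorem exists_mem_P (v : E.Germ) : ∃ β, v ∈ E.P β := by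
  have hv : v ∈ Submodule.span (MeroGerm 1) (E.P 0 : Set E.Germ) := by
    rw [E.span]; trivial
  induction hv using Submodule.span_induction with
  | mem v hv => exact ⟨0, hv⟩
  | zero => exact ⟨0, zero_mem _⟩
  | add v w _ _ hv hw =>
    obtain ⟨β, hv⟩ := hv
    obtain ⟨γ, hw⟩ := hw
    exact ⟨max β γ, add_mem (E.mono (le_max_left _ _) hv) (E.mono (le_max_right _ _) hw)⟩
  | smul f v _ hv =>
    obtain ⟨β, hv⟩ := hv
    exact ⟨_, E.smul_mem_P (t := f.pole) (Or.inr le_rfl) hv⟩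

/-- Finitely many generators of `𝒫₀` have a common pole bound on their coordinates, and powers of
`x` carry it to every `β`. -/
theorem exists_repr_mem_poleLE {κ : Type*} [Finite κ] (b : Module.Basis κ ℂ[X] E.Sec) :
    ∃ n : ℝ, ∀ β, ∀ v ∈ E.P β, ∀ i,
      (b.baseChange (MeroGerm 1)).repr v i ∈ MeroGerm.poleLE 1 (n + β) := by
  obtain ⟨S, hS⟩ := E.fg 0
  have h1 : ∀ᶠ n : ℝ in atTop, ∀ s ∈ S, ∀ i,
      (b.baseChange (MeroGerm 1)).repr s i ∈ MeroGerm.poleLE 1 n := by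
    rw [eventually_all_finset]
    intro s _
    rw [eventually_all]
    intro i
    filter_upwards [eventually_ge_atTop _] with n hn using Or.inr hn
  obtain ⟨n, hn⟩ := h1.exists
  have h2 : ∀ v ∈ E.P 0, ∀ i, (b.baseChange (MeroGerm 1)).repr v i ∈ MeroGerm.poleLE 1 n := by
    intro v hv
    rw [← hS] at hv
    induction hv using Submodule.span_induction with
    | mem v hv => exact hn v hv
    | zero => intro i; simp
    | add v w _ _ hv hw =>
      intro i
      rw [map_add, Finsupp.add_apply]
      exact add_mem (hv i) (hw i)
    | smul f v _ hv =>
      intro i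
      rw [holoGerm_smul_def, map_smul, Finsupp.smul_apply]
      exact (MeroGerm.poleLE 1 n).smul_mem f (hv i)
  -- The extra `1` pays for rounding `β` up, as only integral powers of `x` are available.
  refine ⟨n + 1, fun β v hv i => ?_⟩
  have h3 : MeroGerm.uPow 1 ⌈β⌉ • v ∈ E.P 0 := by
    have := (E.uPow_smul_mem_P_iff ⌈β⌉ ⌈β⌉ v).2 (E.mono (Int.le_ceil β) hv)
    rwa [sub_self] at this
  have h4 := h2 _ h3 i
  rw [map_smul, Finsupp.smul_apply, smul_eq_mul,
    MeroGerm.mul_mem_poleLE_iff (MeroGerm.uPow_ne_zero _), MeroGerm.pole_uPow] at h4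
  refine MeroGerm.poleLE_mono ?_ h4
  push_cast
  linarith [Int.ceil_lt_add_one β]

theorem free : Module.Free ℂ[X] E.Sec :=
  have := E.finite
  have := E.projective
  inferInstance

/-- A basis of the module of global sections. -/
noncomputable def someBasis : Module.Basis (Fin K) ℂ[X] E.Sec :=
  have := E.finite
  have := E.free
  Module.finBasisOfFinrankEq ℂ[X] E.Sec E.rank

/-- The coordinate bound keeps the admissible `β` bounded below, and right continuity makes their
infimum admissible. -/
theorem exists_mem_P_iff_le {v : E.Germ} (hv : v ≠ 0) : ∃ c, ∀ β, v ∈ E.P β ↔ c ≤ β := by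
  obtain ⟨n, hn⟩ := E.exists_repr_mem_poleLE E.someBasis
  obtain ⟨i, hi⟩ : ∃ i, (E.someBasis.baseChange (MeroGerm 1)).repr v i ≠ 0 := by
    by_contra! h
    exact hv ((E.someBasis.baseChange (MeroGerm 1)).repr.map_eq_zero_iff.1 (Finsupp.ext h))
  have hne : {β | v ∈ E.P β}.Nonempty := E.exists_mem_P v
  have hbdd : BddBelow {β | v ∈ E.P β} := by
    refine ⟨((E.someBasis.baseChange (MeroGerm 1)).repr v i).pole - n, fun β hβ => ?_⟩
    linarith [(hn β v hβ i).resolve_left hi]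
  refine ⟨sInf {β | v ∈ E.P β}, fun β => ⟨fun h => csInf_le hbdd h, fun h => E.mono h ?_⟩⟩
  rw [E.rightCont]
  simp only [Submodule.mem_iInf]
  intro γ hγ
  obtain ⟨δ, hδ, hlt⟩ := exists_lt_of_csInf_lt hne hγ
  exact E.mono hlt.le hδ

/-! ### Global sections of minimal order. -/

/-- The coordinates, in a fixed basis, of the global sections of `𝒫_β`. -/
noncomputable def coordP (β : ℝ) : Submodule ℂ (Fin K → ℂ[X]) where
  carrier := {p | (1 : MeroGerm 1) ⊗ₜ[ℂ[X]] E.someBasis.equivFun.symm p ∈ E.P β}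
  zero_mem' := by simp
  add_mem' := by
    intro p q hp hq
    simp only [Set.mem_ofPred_eq, map_add, TensorProduct.tmul_add] at *
    exact add_mem hp hq
  smul_mem' := by
    intro c p hp
    have h1 : c • p = (C c : ℂ[X]) • p := by
      funext i
      simp [Polynomial.smul_eq_C_mul]
    have h2 : (1 : MeroGerm 1) ⊗ₜ[ℂ[X]] E.someBasis.equivFun.symm (c • p) =
        (⟨_, MeroGerm.C_mem_holoGerm c⟩ : HoloGerm 1) •
          ((1 : MeroGerm 1) ⊗ₜ[ℂ[X]] E.someBasis.equivFun.symm p) := by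
      rw [h1, map_smul, ← TensorProduct.smul_tmul, holoGerm_smul_def, TensorProduct.smul_tmul',
        Algebra.smul_def, smul_eq_mul]
    change _ ∈ E.P β
    rw [h2]
    exact (E.P β).smul_mem _ hp

/-- Finiteness of `H⁰(𝒫_β ℰ)`: a bounded pole at `∞` means a bounded degree for polynomial
coordinates. -/
instance finiteDimensional_coordP (β : ℝ) : FiniteDimensional ℂ (E.coordP β) := by
  obtain ⟨n, hn⟩ := E.exists_repr_mem_poleLE E.someBasis
  obtain ⟨N, hN⟩ := exists_nat_gt (n + β)
  let f : (Fin K → degreeLT ℂ N) →ₗ[ℂ] (Fin K → ℂ[X]) :=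
    LinearMap.pi fun i => (degreeLT ℂ N).subtype ∘ₗ LinearMap.proj i
  have : FiniteDimensional ℂ (degreeLT ℂ N) :=
    Module.Finite.equiv (degreeLTEquiv ℂ N).symm
  refine Submodule.finiteDimensional_of_le (S₂ := LinearMap.range f) fun p hp => ?_
  have hp' : ∀ i, p i ∈ degreeLT ℂ N := by
    intro i
    by_cases h0 : p i = 0
    · simp [h0]
    have h := hn β _ hp i
    rw [Module.Basis.baseChange_repr_tmul, ← Module.Basis.equivFun_apply,
      LinearEquiv.apply_symm_apply, Algebra.smul_def, mul_one] at h
    have h1 := MeroGerm.pole_algebraMap (m := 1) (p i) h0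
    have h2 := h.resolve_left h1.1
    rw [h1.2] at h2
    rw [mem_degreeLT, ← natDegree_lt_iff_degree_lt h0]
    push_cast at h2
    have : ((p i).natDegree : ℝ) < N := by linarith
    exact_mod_cast this
  exact ⟨fun i => ⟨p i, hp' i⟩, rfl⟩

/-- Among the global sections outside a proper subspace, one has minimal order at `∞`. -/
theorem exists_minimal_section (W : Submodule (MeroGerm 1) E.Germ)
    (hW : ∃ s : E.Sec, (1 : MeroGerm 1) ⊗ₜ[ℂ[X]] s ∉ W) :
    ∃ (s : E.Sec) (c : ℝ), (1 : MeroGerm 1) ⊗ₜ[ℂ[X]] s ∉ W ∧ (1 : MeroGerm 1) ⊗ₜ[ℂ[X]] s ∈ E.P c ∧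
      ∀ (t : E.Sec) (β : ℝ), (1 : MeroGerm 1) ⊗ₜ[ℂ[X]] t ∉ W →
        (1 : MeroGerm 1) ⊗ₜ[ℂ[X]] t ∈ E.P β → c ≤ β := by
  classical
  have hmem : ∀ (s : E.Sec) β, E.someBasis.equivFun s ∈ E.coordP β ↔
      (1 : MeroGerm 1) ⊗ₜ[ℂ[X]] s ∈ E.P β := by
    intro s β
    change _ ⊗ₜ[ℂ[X]] E.someBasis.equivFun.symm (E.someBasis.equivFun s) ∈ E.P β ↔ _
    rw [LinearEquiv.symm_apply_apply]
  have hex : ∃ n : ℕ, ∃ β, Module.finrank ℂ (E.coordP β) = n ∧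
      ∃ s : E.Sec, (1 : MeroGerm 1) ⊗ₜ[ℂ[X]] s ∉ W ∧ (1 : MeroGerm 1) ⊗ₜ[ℂ[X]] s ∈ E.P β := by
    obtain ⟨s, hs⟩ := hW
    obtain ⟨β, hβ⟩ := E.exists_mem_P ((1 : MeroGerm 1) ⊗ₜ[ℂ[X]] s)
    exact ⟨_, β, rfl, s, hs, hβ⟩
  obtain ⟨β, hβ, s, hsW, hsβ⟩ := Nat.find_spec hex
  obtain ⟨c, hc⟩ := E.exists_mem_P_iff_le (v := (1 : MeroGerm 1) ⊗ₜ[ℂ[X]] s)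
    fun h => hsW (h ▸ zero_mem W)
  refine ⟨s, c, hsW, (hc c).2 le_rfl, fun t γ htW htγ => ?_⟩
  by_contra! hlt
  -- The inclusion is strict because `s` has order `c > γ`.
  have hle : E.coordP γ < E.coordP β := by
    refine lt_of_le_of_ne (fun p hp => E.mono (hlt.le.trans ((hc β).1 hsβ)) hp) fun heq => ?_
    have := (hmem s β).2 hsβ
    rw [← heq, hmem, hc] at this
    linarith
  refine Nat.find_min hex ?_ ⟨γ, rfl, t, htW, htγ⟩
  rw [← hβ]
  exact Submodule.finrank_lt_finrank_of_lt hle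

theorem exists_notMem_of_ne_top {W : Submodule (MeroGerm 1) E.Germ} (hW : W ≠ ⊤) :
    ∃ s : E.Sec, (1 : MeroGerm 1) ⊗ₜ[ℂ[X]] s ∉ W := by
  by_contra! h
  apply hW
  rw [eq_top_iff, ← (E.someBasis.baseChange (MeroGerm 1)).span_eq, Submodule.span_le]
  rintro _ ⟨i, rfl⟩
  rw [Module.Basis.baseChange_apply]
  exact h _

theorem finrank_germ : Module.finrank (MeroGerm 1) E.Germ = K := by
  rw [Module.finrank_eq_card_basis (E.someBasis.baseChange (MeroGerm 1)), Fintype.card_fin]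

/-! ### Successive minima form an adapted basis. -/

/-- Global sections realizing the successive minima of the order at `∞`, together with these
minima. -/
structure IsMinimalSequence (e : Fin K → E.Sec) (c : Fin K → ℝ) : Prop where
  notMem : ∀ i, (1 : MeroGerm 1) ⊗ₜ[ℂ[X]] e i ∉
    Submodule.span (MeroGerm 1) ((fun j => (1 : MeroGerm 1) ⊗ₜ[ℂ[X]] e j) '' Set.Iio i)
  mem : ∀ i, (1 : MeroGerm 1) ⊗ₜ[ℂ[X]] e i ∈ E.P (c i)
  le : ∀ i (t : E.Sec) (β : ℝ), (1 : MeroGerm 1) ⊗ₜ[ℂ[X]] t ∉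
    Submodule.span (MeroGerm 1) ((fun j => (1 : MeroGerm 1) ⊗ₜ[ℂ[X]] e j) '' Set.Iio i) →
      (1 : MeroGerm 1) ⊗ₜ[ℂ[X]] t ∈ E.P β → c i ≤ β

theorem exists_isMinimalSequence : ∃ e c, E.IsMinimalSequence e c := by
  classical
  -- Indexing by `ℕ` lets the induction extend a sequence by `Function.update`; the values from `k`
  -- on are arbitrary.
  have key : ∀ k ≤ K, ∃ (e : ℕ → E.Sec) (c : ℕ → ℝ), ∀ i < k,
      (1 : MeroGerm 1) ⊗ₜ[ℂ[X]] e i ∉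
        Submodule.span (MeroGerm 1) ((fun j => (1 : MeroGerm 1) ⊗ₜ[ℂ[X]] e j) '' Set.Iio i) ∧
      (1 : MeroGerm 1) ⊗ₜ[ℂ[X]] e i ∈ E.P (c i) ∧
      ∀ (t : E.Sec) (β : ℝ), (1 : MeroGerm 1) ⊗ₜ[ℂ[X]] t ∉
        Submodule.span (MeroGerm 1) ((fun j => (1 : MeroGerm 1) ⊗ₜ[ℂ[X]] e j) '' Set.Iio i) →
          (1 : MeroGerm 1) ⊗ₜ[ℂ[X]] t ∈ E.P β → c i ≤ β := by
    intro k
    induction k with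
    | zero => exact fun _ => ⟨fun _ => 0, fun _ => 0, fun i hi => absurd hi (Nat.not_lt_zero i)⟩
    | succ k ih =>
      intro hk
      obtain ⟨e, c, h⟩ := ih (by omega)
      -- Fewer than `K` vectors cannot span a space of dimension `K`.
      have hne : Submodule.span (MeroGerm 1)
          ((fun j => (1 : MeroGerm 1) ⊗ₜ[ℂ[X]] e j) '' Set.Iio k) ≠ ⊤ := by
        intro htop
        have h1 := finrank_span_finset_le_card (R := MeroGerm 1)
          ((Finset.Iio k).image fun j => (1 : MeroGerm 1) ⊗ₜ[ℂ[X]] e j)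
        rw [Set.finrank, Finset.coe_image, Finset.coe_Iio, htop, finrank_top, E.finrank_germ] at h1
        have h2 := h1.trans Finset.card_image_le
        rw [Nat.card_Iio] at h2
        omega
      obtain ⟨s, d, hs⟩ := E.exists_minimal_section _ (E.exists_notMem_of_ne_top hne)
      refine ⟨Function.update e k s, Function.update c k d, fun i hi => ?_⟩
      have himage : (fun j => (1 : MeroGerm 1) ⊗ₜ[ℂ[X]] Function.update e k s j) '' Set.Iio i =
          (fun j => (1 : MeroGerm 1) ⊗ₜ[ℂ[X]] e j) '' Set.Iio i := by
        refine Set.image_congr fun j hj => ?_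
        have : j ≠ k := by have := Set.mem_Iio.1 hj; omega
        rw [Function.update_of_ne this]
      rw [himage]
      rcases Nat.lt_succ_iff_lt_or_eq.1 hi with hi | rfl
      · rw [Function.update_of_ne hi.ne, Function.update_of_ne hi.ne]
        exact h i hi
      · rw [Function.update_self, Function.update_self]
        exact hs
  obtain ⟨e, c, h⟩ := key K le_rfl
  have himage : ∀ i : Fin K, (fun j => (1 : MeroGerm 1) ⊗ₜ[ℂ[X]] e j) '' Set.Iio (i : ℕ) =
      (fun j : Fin K => (1 : MeroGerm 1) ⊗ₜ[ℂ[X]] e j) '' Set.Iio i := by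
    intro i
    ext v
    constructor
    · rintro ⟨j, hj, rfl⟩
      exact ⟨⟨j, lt_trans hj i.2⟩, hj, rfl⟩
    · rintro ⟨j, hj, rfl⟩
      exact ⟨j, hj, rfl⟩
  refine ⟨fun i => e i, fun i => c i, ⟨fun i => ?_, fun i => (h i i.2).2.1, fun i => ?_⟩⟩
  · rw [← himage]
    exact (h i i.2).1
  · rw [← himage]
    exact (h i i.2).2.2

end FilteredBundle

/-- Supplies the competitors against the minimality of `eⱼ`: the terms before `j` are absorbed by
the span, so the `j`-th term alone decides. -/
theorem sum_smul_notMem_span_of_triangular {F V : Type*} [Field F] [AddCommGroup V] [Module F V]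
    {n : ℕ} {v : Fin n → V} {j : Fin n} (hv : v j ∉ Submodule.span F (v '' Set.Iio j))
    {f : Fin n → F} (hj : f j ≠ 0) (hf : ∀ i, j < i → f i = 0) :
    ∑ i, f i • v i ∉ Submodule.span F (v '' Set.Iio j) := by
  intro h
  rw [← Finset.add_sum_erase _ _ (Finset.mem_univ j)] at h
  have h2 : ∑ i ∈ Finset.univ.erase j, f i • v i ∈ Submodule.span F (v '' Set.Iio j) := by
    refine Submodule.sum_mem _ fun i hi => ?_
    rcases lt_trichotomy i j with hij | hij | hij
    · exact Submodule.smul_mem _ _ (Submodule.subset_span ⟨i, hij, rfl⟩)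
    · exact absurd hij (Finset.ne_of_mem_erase hi)
    · simp [hf i hij]
  rw [Submodule.add_mem_iff_left _ h2, Submodule.smul_mem_iff _ hj] at h
  exact hv h

namespace FilteredBundle

variable {K : ℕ} {E : FilteredBundle K}

theorem exists_lt_sum_mem_P {ι : Type*} (s : Finset ι) (w : ι → E.Germ) (c : ℝ)
    (h : ∀ i ∈ s, ∃ β < c, w i ∈ E.P β) : ∃ β < c, ∑ i ∈ s, w i ∈ E.P β := by
  classical
  induction s using Finset.induction_on with
  | empty => exact ⟨c - 1, by linarith, by simp⟩
  | insert a s ha ih =>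
    obtain ⟨β, hβ, h1⟩ := ih fun i hi => h i (Finset.mem_insert_of_mem hi)
    obtain ⟨γ, hγ, h2⟩ := h a (Finset.mem_insert_self a s)
    refine ⟨max β γ, max_lt hβ hγ, ?_⟩
    rw [Finset.sum_insert ha]
    exact add_mem (E.mono (le_max_right _ _) h2) (E.mono (le_max_left _ _) h1)

theorem one_tmul_sum {ι : Type*} (s : Finset ι) (p : ι → ℂ[X]) (e : ι → E.Sec) :
    (1 : MeroGerm 1) ⊗ₜ[ℂ[X]] (∑ i ∈ s, p i • e i) =
      ∑ i ∈ s, algebraMap ℂ[X] (MeroGerm 1) (p i) • ((1 : MeroGerm 1) ⊗ₜ[ℂ[X]] e i) := by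
  rw [TensorProduct.tmul_sum]
  refine Finset.sum_congr rfl fun i _ => ?_
  rw [← TensorProduct.smul_tmul, TensorProduct.smul_tmul', Algebra.smul_def, smul_eq_mul]

theorem one_tmul_injective :
    Function.Injective fun s : E.Sec => (1 : MeroGerm 1) ⊗ₜ[ℂ[X]] s :=
  have := E.free
  Module.Flat.tensorProduct_mk_injective ℂ[X] E.Sec (MeroGerm 1)

namespace IsMinimalSequence

variable {e : Fin K → E.Sec} {c : Fin K → ℝ} (h : E.IsMinimalSequence e c)
include h

/-- `eⱼ` is also outside the smaller span attached to `i`, so it competes for `cᵢ`. -/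
theorem monotone : Monotone c := by
  intro i j hij
  refine h.le i (e j) (c j) (fun hmem => h.notMem j ?_) (h.mem j)
  exact Submodule.span_mono (Set.image_mono (Set.Iio_subset_Iio hij)) hmem

theorem linearIndependent :
    LinearIndependent (MeroGerm 1) fun i => (1 : MeroGerm 1) ⊗ₜ[ℂ[X]] e i := by
  classical
  rw [Fintype.linearIndependent_iff]
  intro f hf
  by_contra! hne
  obtain ⟨i, hi⟩ := hne
  obtain ⟨j, hj, hmax⟩ := (Finset.univ.filter fun i => f i ≠ 0).exists_max_image id
    ⟨i, by simpa using hi⟩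
  refine sum_smul_notMem_span_of_triangular (h.notMem j) (f := f) (by simpa using hj)
    (fun i hi => ?_) (hf ▸ zero_mem _)
  by_contra h0
  exact absurd (hmax i (by simpa using h0)) (not_le.2 hi)

theorem exists_coeff (v : E.Germ) :
    ∃ f : Fin K → MeroGerm 1, v = ∑ i, f i • ((1 : MeroGerm 1) ⊗ₜ[ℂ[X]] e i) := by
  have hcard : Fintype.card (Fin K) = Module.finrank (MeroGerm 1) E.Germ := by
    rw [E.finrank_germ, Fintype.card_fin]
  have hfin : Module.Finite (MeroGerm 1) E.Germ :=
    .of_basis (E.someBasis.baseChange (MeroGerm 1))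
  have hspan := h.linearIndependent.span_eq_top_of_card_eq_finrank' hcard
  have hv : v ∈ Submodule.span (MeroGerm 1)
      (Set.range fun i => (1 : MeroGerm 1) ⊗ₜ[ℂ[X]] e i) := hspan ▸ trivial
  obtain ⟨f, hf⟩ := (Submodule.mem_span_range_iff_exists_fun _).1 hv
  exact ⟨f, hf.symm⟩

/-- Subtract from a section the polynomial parts of its coefficients in `ℂ({x})`. If a remainder is
left, with last nonzero coefficient at `j`, it lies outside the span before `eⱼ`. Its coefficients
vanish at `∞` and `cᵢ ≤ cⱼ` for `i ≤ j`, so its order is at most `cⱼ - 1`, against minimality. -/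
theorem span_eq_top : Submodule.span ℂ[X] (Set.range e) = ⊤ := by
  classical
  rw [eq_top_iff]
  intro t _
  obtain ⟨f, hf⟩ := h.exists_coeff ((1 : MeroGerm 1) ⊗ₜ[ℂ[X]] t)
  choose p hp using fun i => MeroGerm.exists_sub_algebraMap_mem (f i)
  have hs : (1 : MeroGerm 1) ⊗ₜ[ℂ[X]] (t - ∑ i, p i • e i) =
      ∑ i, (f i - algebraMap ℂ[X] (MeroGerm 1) (p i)) • ((1 : MeroGerm 1) ⊗ₜ[ℂ[X]] e i) := by
    rw [TensorProduct.tmul_sub, one_tmul_sum, hf, ← Finset.sum_sub_distrib]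
    simp only [germ_sub_smul]
  by_cases h0 : ∀ i, f i - algebraMap ℂ[X] (MeroGerm 1) (p i) = 0
  · have h1 : t - ∑ i, p i • e i = 0 := by
      apply one_tmul_injective (E := E)
      beta_reduce
      rw [hs, TensorProduct.tmul_zero]
      exact Finset.sum_eq_zero fun i _ => by rw [h0, zero_smul]
    rw [sub_eq_zero.1 h1]
    exact Submodule.sum_mem _ fun i _ => Submodule.smul_mem _ _ (Submodule.subset_span ⟨i, rfl⟩)
  · push Not at h0
    obtain ⟨i, hi⟩ := h0
    obtain ⟨j, hj, hmax⟩ := (Finset.univ.filter fun i =>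
      f i - algebraMap ℂ[X] (MeroGerm 1) (p i) ≠ 0).exists_max_image id ⟨i, by simpa using hi⟩
    have hgt : ∀ i, j < i → f i - algebraMap ℂ[X] (MeroGerm 1) (p i) = 0 := by
      intro i hi
      by_contra h0
      exact absurd (hmax i (Finset.mem_filter.2 ⟨Finset.mem_univ _, h0⟩)) (not_le.2 hi)
    have hnot := sum_smul_notMem_span_of_triangular (h.notMem j)
      (f := fun i => f i - algebraMap ℂ[X] (MeroGerm 1) (p i)) (Finset.mem_filter.1 hj).2 hgt
    rw [← hs] at hnot
    have hle := h.le j _ (c j - 1) hnot (by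
      rw [hs]
      refine Submodule.sum_mem _ fun i _ => ?_
      rcases le_or_gt i j with hij | hij
      · exact E.mono (by linarith [h.monotone hij]) (E.smul_mem_P (hp i) (h.mem i))
      · rw [hgt i hij, zero_smul]
        exact zero_mem _)
    linarith

/-- Leading terms cannot cancel. Otherwise divide by a dominant coefficient `fⱼ`, and replace `fᵢ /
fⱼ` by its polynomial part for `i ≤ j` and by `0` for `i > j`. The divided sum and all the errors
have order below `cⱼ`, so this yields a global section of order below `cⱼ` outside the span before
`eⱼ`. -/
theorem orthogonal {β : ℝ} (f : Fin K → MeroGerm 1)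
    (hf : ∑ i, f i • ((1 : MeroGerm 1) ⊗ₜ[ℂ[X]] e i) ∈ E.P β) (i : Fin K) :
    f i ∈ MeroGerm.poleLE 1 (β - c i) := by
  classical
  by_contra hi
  rw [MeroGerm.mem_poleLE, not_or, not_le] at hi
  -- Ties in `pole fᵢ + cᵢ` go to the largest index, so the terms after `j` are strictly smaller and
  -- may be dropped.
  obtain ⟨j, hj, hmax⟩ := (Finset.univ.filter fun i => f i ≠ 0).exists_max_image
    (fun i => toLex ((f i).pole + c i, i)) ⟨i, by simpa using hi.1⟩
  replace hj : f j ≠ 0 := by simpa using hj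
  have hmax' : ∀ i, f i ≠ 0 →
      (f i).pole + c i < (f j).pole + c j ∨ (f i).pole + c i = (f j).pole + c j ∧ i ≤ j := by
    intro i hi
    exact Prod.Lex.toLex_le_toLex.1 (hmax i (by simpa using hi))
  have hβ : β - (f j).pole < c j := by
    rcases hmax' i hi.1 with h' | h' <;> linarith
  have hjinv : (f j)⁻¹ ≠ 0 := inv_ne_zero hj
  have hpinv : ((f j)⁻¹).pole = -(f j).pole := by
    have h1 := MeroGerm.pole_mul hj hjinv
    have h2 := MeroGerm.pole_uPow (m := 1) 0
    rw [MeroGerm.uPow_zero] at h2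
    rw [mul_inv_cancel₀ hj, h2] at h1
    omega
  have hq : ∀ i, ∃ p : ℂ[X], (j < i → p = 0) ∧ (i = j → p ≠ 0) ∧
      ∃ γ < c j, ((f j)⁻¹ * f i - algebraMap ℂ[X] (MeroGerm 1) p) •
        ((1 : MeroGerm 1) ⊗ₜ[ℂ[X]] e i) ∈ E.P γ := by
    intro i
    rcases lt_or_ge j i with hij | hij
    · refine ⟨0, fun _ => rfl, fun h0 => absurd h0 hij.ne', ?_⟩
      rw [map_zero, sub_zero]
      by_cases h0 : f i = 0
      · exact ⟨c j - 1, by linarith, by simp [h0]⟩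
      refine ⟨c i + ((f i).pole - (f j).pole), ?_, E.smul_mem_P (Or.inr ?_) (h.mem i)⟩
      · rcases hmax' i h0 with h' | h'
        · linarith
        · exact absurd h'.2 (not_le.2 hij)
      · rw [MeroGerm.pole_mul hjinv h0, hpinv]
        push_cast
        linarith
    · obtain ⟨p, hp⟩ := MeroGerm.exists_sub_algebraMap_mem ((f j)⁻¹ * f i)
      refine ⟨p, fun h0 => absurd h0 (not_lt.2 hij), ?_, c j - 1, by linarith,
        E.mono (by linarith [h.monotone hij]) (E.smul_mem_P hp (h.mem i))⟩
      -- At `i = j` the quotient is `1`, which does not vanish at `∞`, so its polynomial part is not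
      -- `0`.
      rintro rfl rfl
      rw [map_zero, sub_zero, inv_mul_cancel₀ hj, ← MeroGerm.uPow_zero,
        MeroGerm.uPow_mem_poleLE] at hp
      norm_num at hp
  choose p hp1 hp2 hp3 using hq
  obtain ⟨γ, hγ, hsum⟩ := exists_lt_sum_mem_P Finset.univ _ (c j) fun i _ => hp3 i
  have hv := E.smul_mem_P (f := (f j)⁻¹) (t := -(f j).pole) (Or.inr (by rw [hpinv]; simp)) hf
  have hs : (1 : MeroGerm 1) ⊗ₜ[ℂ[X]] (∑ i, p i • e i) =
      (f j)⁻¹ • (∑ i, f i • ((1 : MeroGerm 1) ⊗ₜ[ℂ[X]] e i)) -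
      ∑ i, ((f j)⁻¹ * f i - algebraMap ℂ[X] (MeroGerm 1) (p i)) •
        ((1 : MeroGerm 1) ⊗ₜ[ℂ[X]] e i) := by
    rw [one_tmul_sum, Finset.smul_sum, ← Finset.sum_sub_distrib]
    refine Finset.sum_congr rfl fun i _ => ?_
    rw [germ_sub_smul, mul_smul, sub_sub_cancel]
  have hnot : (1 : MeroGerm 1) ⊗ₜ[ℂ[X]] (∑ i, p i • e i) ∉ Submodule.span (MeroGerm 1)
      ((fun j => (1 : MeroGerm 1) ⊗ₜ[ℂ[X]] e j) '' Set.Iio j) := by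
    rw [one_tmul_sum]
    exact sum_smul_notMem_span_of_triangular (h.notMem j)
      (f := fun i => algebraMap ℂ[X] (MeroGerm 1) (p i))
      (MeroGerm.pole_algebraMap _ (hp2 j rfl)).1 fun i hi => by rw [hp1 i hi, map_zero]
  have hle := h.le j _ (max (β - (f j).pole) γ) hnot (by
    rw [hs]
    exact sub_mem (E.mono (le_max_left _ _) hv) (E.mono (le_max_right _ _) hsum))
  exact absurd hle (not_le.2 (max_lt hβ hγ))

theorem exists_isSplitting : ∃ b : Module.Basis (Fin K) ℂ[X] E.Sec, E.IsSplitting b c := by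
  have hli : LinearIndependent ℂ[X] e := by
    rw [Fintype.linearIndependent_iff]
    intro p hp i
    have h1 : ∑ i, algebraMap ℂ[X] (MeroGerm 1) (p i) • ((1 : MeroGerm 1) ⊗ₜ[ℂ[X]] e i) = 0 := by
      rw [← one_tmul_sum, hp, TensorProduct.tmul_zero]
    exact MeroGerm.algebraMap_injective
      ((Fintype.linearIndependent_iff.1 h.linearIndependent _ h1 i).trans (map_zero _).symm)
  let b := Module.Basis.mk hli h.span_eq_top.ge
  have hb : ∀ i, b i = e i := fun i => Module.Basis.mk_apply _ _ i
  refine ⟨b, fun β v => ?_⟩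
  have hv : v = ∑ i, (b.baseChange (MeroGerm 1)).repr v i • ((1 : MeroGerm 1) ⊗ₜ[ℂ[X]] e i) := by
    conv_lhs => rw [← (b.baseChange (MeroGerm 1)).sum_repr v]
    simp only [Module.Basis.baseChange_apply, hb]
  constructor
  · intro hmem
    rw [hv] at hmem
    exact h.orthogonal _ hmem
  · intro hmem
    rw [hv]
    refine Submodule.sum_mem _ fun i _ => ?_
    have := E.smul_mem_P (hmem i) (h.mem i)
    rwa [add_sub_cancel] at this

end IsMinimalSequence

/-- Every filtered bundle on `(ℂℙ¹, {∞})` splits into filtered line bundles. -/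
theorem exists_splitsAs (E : FilteredBundle K) : ∃ α : Fin K → ℝ, E.SplitsAs α := by
  obtain ⟨e, c, h⟩ := E.exists_isMinimalSequence
  obtain ⟨b, hb⟩ := h.exists_isSplitting
  exact ⟨fun i => -c i, IsSplitting.splitsAs (e := b) (by simpa using hb)⟩

end FilteredBundle

/-! ### Pullbacks and goodness -/

theorem repr_pullbackGerm (m : ℕ) [NeZero m] {M : Type*} [AddCommGroup M] [Module ℂ[X] M]
    {ι : Type*} (e : Module.Basis ι ℂ[X] M) (v : GermModule 1 M) (i : ι) :
    (e.baseChange (MeroGerm m)).repr (pullbackGerm m M v) i =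
      MeroGerm.pullback m ((e.baseChange (MeroGerm 1)).repr v i) := by
  induction v using TensorProduct.induction_on with
  | zero => simp
  | add v w hv hw =>
    rw [map_add, map_add, map_add, Finsupp.add_apply, Finsupp.add_apply, hv, hw, map_add]
  | tmul f s =>
    rw [pullbackGerm, LinearMap.rTensor_tmul, Module.Basis.baseChange_repr_tmul,
      Module.Basis.baseChange_repr_tmul, map_smul]
    rfl

/-- Pulling back multiplies poles by `m`, so `eᵢ` gets order `m cᵢ` on the cover. Conversely, each
component of `v` along the basis is a holomorphic multiple of a single generator of `𝒫_a`. -/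
theorem FilteredBundle.IsSplitting.mem_pullbackP_iff {K : ℕ} {E : FilteredBundle K} {ι : Type*}
    [Fintype ι] {e : Module.Basis ι ℂ[X] E.Sec} {c : ι → ℝ} (h : E.IsSplitting e c) (m : ℕ)
    [NeZero m] (a : ℝ) (v : GermModule m E.Sec) :
    v ∈ E.pullbackP m a ↔
      ∀ i, (e.baseChange (MeroGerm m)).repr v i ∈ MeroGerm.poleLE m (a - m * c i) := by
  classical
  constructor
  · intro hv i
    rw [FilteredBundle.pullbackP] at hv
    induction hv using Submodule.span_induction with
    | mem v hv =>
      obtain ⟨n, β, s, hs, hle, rfl⟩ := hv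
      rw [map_smul, Finsupp.smul_apply, repr_pullbackGerm, smul_eq_mul]
      have h1 := MeroGerm.pullback_mem_poleLE (m := m) ((h β s).1 hs i)
      refine MeroGerm.poleLE_mono ?_ (MeroGerm.mul_mem_poleLE
        (MeroGerm.uPow_mem_poleLE.2 le_rfl) h1)
      push_cast
      linarith
    | zero => simp
    | add v w _ _ hv hw =>
      rw [map_add, Finsupp.add_apply]
      exact add_mem hv hw
    | smul f v _ hv =>
      rw [holoGerm_smul_def, map_smul, Finsupp.smul_apply]
      exact (MeroGerm.poleLE m _).smul_mem f hv
  · intro hv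
    rw [← (e.baseChange (MeroGerm m)).sum_repr v]
    refine Submodule.sum_mem _ fun i _ => ?_
    obtain ⟨f, hf, hfe⟩ := MeroGerm.mem_poleLE_iff_exists.1 (hv i)
    rw [hfe, mul_smul]
    refine (E.pullbackP m a).smul_mem (⟨f, hf⟩ : HoloGerm m) (Submodule.subset_span
      ⟨⌊a - m * c i⌋, c i, (1 : MeroGerm 1) ⊗ₜ[ℂ[X]] e i, ?_, ?_, ?_⟩)
    · rw [h]
      intro j
      rw [Module.Basis.baseChange_repr_tmul, Module.Basis.repr_self, Finsupp.single_apply]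
      split_ifs with hij
      · rw [← hij, sub_self, one_smul, ← MeroGerm.uPow_zero, MeroGerm.uPow_mem_poleLE]
        simp
      · simp
    · linarith [Int.floor_le (a - m * c i)]
    · rw [pullbackGerm, LinearMap.rTensor_tmul, Module.Basis.baseChange_apply]
      congr 2

/-- The generators of the lines `L i` are eigenvectors of order `0`; applied to them with `a = 0`,
the logarithmic condition bounds the eigenvalues themselves. -/
theorem IsUnramifiedlyGoodStandard.exists_basis {m : ℕ} {V : Type*} [AddCommGroup V]
    [Module (MeroGerm m) V] {ι : Type*} [Fintype ι] [DecidableEq ι]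
    {P : ℝ → Submodule (HoloGerm m) V} {φ : V →ₗ[MeroGerm m] V}
    {𝔞 : ι → ℂ → ℂ} {h𝔞 : ∀ i, MeromorphicAt (𝔞 i) 0}
    (h : IsUnramifiedlyGoodStandard P φ 𝔞 h𝔞) :
    ∃ ε : Module.Basis ι (MeroGerm m) V,
      (∀ a v, v ∈ P a ↔ ∀ i, ε.repr v i ∈ MeroGerm.poleLE m a) ∧
      ∀ i, ∃ g : MeroGerm m, φ (ε i) = g • ε i ∧
        g - MeroGerm.of m (deriv (𝔞 i)) (h𝔞 i).deriv ∈ MeroGerm.poleLE m 1 := by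
  obtain ⟨L, hL, hP, hφ, hlog, hgen⟩ := h
  choose e he0 heL hmem using hgen
  have heL' : ∀ i, e i ∈ L i := fun i => by
    rw [heL i]
    exact Submodule.mem_span_singleton_self _
  have hli : LinearIndependent (MeroGerm m) e :=
    hL.submodule_iSupIndep.linearIndependent L heL' he0
  have hspan : Submodule.span (MeroGerm m) (Set.range e) = ⊤ := by
    rw [← hL.submodule_iSup_eq_top, Submodule.span_range_eq_iSup]
    exact iSup_congr fun i => (heL i).symm
  let ε := Module.Basis.mk hli hspan.ge
  have hε : ∀ i, ε i = e i := fun i => Module.Basis.mk_apply _ _ i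
  have hline : ∀ i a v, (v ∈ L i ∧ v ∈ P a) ↔ ∃ f ∈ MeroGerm.poleLE m a, v = f • e i := by
    intro i a v
    rw [hmem]
    constructor
    · rintro ⟨f, hf, rfl⟩
      exact ⟨_, MeroGerm.mem_poleLE_iff_exists.2 ⟨f, hf, rfl⟩, rfl⟩
    · rintro ⟨g, hg, rfl⟩
      obtain ⟨f, hf, rfl⟩ := MeroGerm.mem_poleLE_iff_exists.1 hg
      exact ⟨f, hf, rfl⟩
  refine ⟨ε, fun a v => ⟨fun hv i => ?_, fun hv => ?_⟩, fun i => ?_⟩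
  · obtain ⟨w, hw, rfl⟩ := (hP a v).1 hv
    choose f hf hwf using fun i => (hline i a (w i)).1 (hw i)
    have h1 : ∑ i, w i = ∑ i, f i • ε i := Finset.sum_congr rfl fun i _ => by rw [hwf, hε]
    rw [h1, ε.repr_sum_self]
    exact hf i
  · rw [← ε.sum_repr v]
    refine Submodule.sum_mem _ fun i _ => ?_
    exact ((hline i a _).2 ⟨_, hv i, by rw [hε]⟩).2
  · have h1 := hφ i _ (heL' i)
    rw [heL i] at h1
    obtain ⟨g, hg⟩ := Submodule.mem_span_singleton.1 h1
    refine ⟨g, by rw [hε, hg], ?_⟩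
    have he : e i ∈ P 0 := ((hline i 0 _).2 ⟨1, by
      rw [← MeroGerm.uPow_zero, MeroGerm.uPow_mem_poleLE]; simp, (one_smul _ _).symm⟩).2
    have h2 := hlog i 0 _ (heL' i) he
    rw [← hg, ← sub_smul, zero_add] at h2
    obtain ⟨f, hf, hfe⟩ := (hline i 1 _).1 ⟨(L i).smul_mem _ (heL' i), h2⟩
    rwa [smul_left_injective (MeroGerm m) (he0 i) hfe]

theorem meromorphicOrderAt_zpow_zero (n : ℤ) :
    meromorphicOrderAt (fun u : ℂ => u ^ n) 0 = n := by
  rw [← MeroGerm.ord_of (m := 1) (meromorphicAt_zpow n)]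
  exact MeroGerm.ord_uPow n

theorem meromorphicOrderAt_singularType (K N : ℕ) [NeZero K] (r : Fin K) :
    meromorphicOrderAt (singularType K N r) 0 = (-(2 * ((N : ℤ) + K)) : ℤ) := by
  classical
  have hK : (K : ℂ) ≠ 0 := Nat.cast_ne_zero.2 (NeZero.ne K)
  have hKN : (K : ℂ) + N ≠ 0 := by
    have := NeZero.pos K
    exact_mod_cast (by omega : K + N ≠ 0)
  have h : singularType K N r = (fun _ : ℂ => (K : ℂ) / ((K : ℂ) + N) *
      Complex.exp (2 * Real.pi * Complex.I * ((r : ℕ) : ℂ) / K)) *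
      fun u : ℂ => u ^ (-(2 * ((N : ℤ) + K))) := rfl
  rw [h, meromorphicOrderAt_mul (MeromorphicAt.const _ 0) (meromorphicAt_zpow _),
    meromorphicOrderAt_const, if_neg (mul_ne_zero (div_ne_zero hK hKN) (Complex.exp_ne_zero _)),
    meromorphicOrderAt_zpow_zero, zero_add]

theorem MeroGerm.ord_deriv {m : ℕ} {f : ℂ → ℂ} (hf : MeromorphicAt f 0) {n : ℤ} (hn : n ≠ 0)
    (h : meromorphicOrderAt f 0 = n) : (of m (deriv f) hf.deriv).ord = (n - 1 : ℤ) := by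
  rw [ord_of, meromorphicOrderAt_deriv_eq_sub_one (Int.cast_ne_zero.2 hn) h]

/-- The Higgs field of an object of `𝒞_{K,N}` shifts the pulled back filtration by `2N`. -/
theorem CObj.mem_pullbackP_iff {K N : ℕ} [NeZero K] (E : CObj K N) (a : ℝ)
    (v : GermModule (2 * K) E.Sec) :
    v ∈ E.pullbackP (2 * K) a ↔
      germMap (2 * K) E.φ v ∈ E.pullbackP (2 * K) (a + 2 * N) := by
  have hK : 0 < K := NeZero.pos K
  obtain ⟨ε, hε, hφ⟩ := E.good.exists_basis
  set D := MeroGerm.of (2 * K) (deriv fun u : ℂ => u ^ (-((2 * K : ℕ) : ℤ)))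
    (meromorphicAt_zpow _).deriv with hD
  have hDord : D.ord = (-(((2 * K : ℕ) : ℤ) + 1) : ℤ) := by
    rw [hD, MeroGerm.ord_deriv (meromorphicAt_zpow _) (by omega) (meromorphicOrderAt_zpow_zero _)]
    congr 1
    ring
  have hD0 : D ≠ 0 := MeroGerm.ne_zero_of_ord_eq hDord
  have hDpole := MeroGerm.pole_eq hDord
  -- The eigenvalue of `φ du` differs from `𝔞ᵢ'` by at most a simple pole, so its pole has order
  -- `2(N + K) + 1`. Dividing by `dz/du`, of pole order `2K + 1`, leaves exactly `2N`; exactness is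
  -- what gives an equivalence and not just an inclusion.
  have hev : ∀ i, ∃ g : MeroGerm (2 * K), g ≠ 0 ∧ g.pole = 2 * N ∧
      germMap (2 * K) E.φ (ε i) = g • ε i := by
    intro i
    obtain ⟨h, hh, hlog⟩ := hφ i
    have hSord := MeroGerm.ord_deriv (m := 2 * K) (meromorphicAt_singularType K N i) (by omega)
      (meromorphicOrderAt_singularType K N i)
    have hS0 := MeroGerm.ne_zero_of_ord_eq hSord
    have hSpole : (MeroGerm.of (2 * K) (deriv (singularType K N i))
        (meromorphicAt_singularType K N i).deriv).pole = 2 * ((N : ℤ) + K) + 1 :=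
      MeroGerm.pole_eq (by rw [hSord]; congr 1; ring)
    obtain ⟨h0, hpole⟩ := MeroGerm.pole_add_eq_of_mem hS0 hlog (by
      rw [hSpole]
      have : (0 : ℝ) < K := Nat.cast_pos.2 hK
      push_cast
      have : (0 : ℝ) ≤ N := Nat.cast_nonneg N
      linarith)
    rw [add_sub_cancel] at h0 hpole
    have hsplit : h = D * (D⁻¹ * h) := (mul_inv_cancel_left₀ hD0 h).symm
    have hg0 : D⁻¹ * h ≠ 0 := mul_ne_zero (inv_ne_zero hD0) h0
    refine ⟨D⁻¹ * h, hg0, ?_, ?_⟩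
    · have h1 := MeroGerm.pole_mul hD0 hg0
      rw [← hsplit, hpole, hSpole, hDpole] at h1
      push_cast at h1
      linarith
    · have h1 : D • germMap (2 * K) E.φ (ε i) = h • ε i := hh
      rw [mul_smul, ← h1, smul_smul, inv_mul_cancel₀ hD0, one_smul]
  choose g hg0 hgpole hgε using hev
  have hrepr : ∀ i, ε.repr (germMap (2 * K) E.φ v) i = g i * ε.repr v i := by
    intro i
    have h1 : germMap (2 * K) E.φ v = ∑ j, (g j * ε.repr v j) • ε j := by
      conv_lhs => rw [← ε.sum_repr v]
      rw [map_sum]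
      refine Finset.sum_congr rfl fun j _ => ?_
      rw [map_smul, hgε, smul_smul, mul_comm (g j)]
    rw [h1, ε.repr_sum_self]
  refine (hε _ _).trans (Iff.trans (forall_congr' fun i => ?_) (hε _ _).symm)
  rw [hrepr, MeroGerm.mul_mem_poleLE_iff (hg0 i), hgpole]
  push_cast
  rw [add_sub_cancel_right]

/-! ### Comparison of the orders of adapted bases -/

/-- `x` must be the maximum of the `y j` with `q j`, a nonempty family since otherwise every real
number would be at least `x`. It serves to pick a coordinate that attains the order of a section. -/
theorem exists_eq_of_forall_le_iff {ι : Type*} [Finite ι] {x : ℝ} {q : ι → Prop} {y : ι → ℝ}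
    (h : ∀ a, x ≤ a ↔ ∀ j, q j → y j ≤ a) : ∃ j, q j ∧ y j = x := by
  classical
  have := Fintype.ofFinite ι
  have hne : (Finset.univ.filter q).Nonempty := by
    by_contra hempty
    have h1 := (h (x - 1)).2 fun j hj => absurd ⟨j, by simpa using hj⟩ hempty
    linarith
  obtain ⟨j, hj, hmax⟩ := (Finset.univ.filter q).exists_max_image y hne
  replace hj : q j := by simpa using hj
  exact ⟨j, hj, le_antisymm ((h x).1 le_rfl j hj) ((h (y j)).2 fun i hi => hmax i (by simpa using hi))⟩

theorem repr_one_tmul_self_mem_poleLE {m : ℕ} {M : Type*} [AddCommGroup M] [Module ℂ[X] M]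
    {ι : Type*} (e : Module.Basis ι ℂ[X] M) (i : ι) (t : ι → ℝ) :
    (∀ j, (e.baseChange (MeroGerm m)).repr (1 ⊗ₜ[ℂ[X]] e i) j ∈ MeroGerm.poleLE m (t j)) ↔
      0 ≤ t i := by
  classical
  simp only [Module.Basis.baseChange_repr_tmul, Module.Basis.repr_self, Finsupp.single_apply]
  constructor
  · intro h
    have := h i
    rw [if_pos rfl, one_smul, ← MeroGerm.uPow_zero, MeroGerm.uPow_mem_poleLE] at this
    simpa using this
  · intro h j
    split_ifs with hij
    · rw [one_smul, ← MeroGerm.uPow_zero, MeroGerm.uPow_mem_poleLE, ← hij]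
      simpa using h
    · simp

theorem repr_one_tmul_mem_poleLE {m : ℕ} [NeZero m] {M : Type*} [AddCommGroup M] [Module ℂ[X] M]
    {ι : Type*} (e : Module.Basis ι ℂ[X] M) (s : M) (j : ι) (t : ℝ) :
    (e.baseChange (MeroGerm m)).repr (1 ⊗ₜ[ℂ[X]] s) j ∈ MeroGerm.poleLE m t ↔
      (e.repr s j ≠ 0 → (m : ℝ) * (e.repr s j).natDegree ≤ t) := by
  rw [Module.Basis.baseChange_repr_tmul, Algebra.smul_def, mul_one]
  by_cases h : e.repr s j = 0
  · simp [h]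
  · have h1 := MeroGerm.pole_algebraMap (m := m) _ h
    rw [MeroGerm.mem_poleLE, h1.2]
    push_cast
    simp [h, h1.1]

/-- The order of `eᵢ` is `cᵢ` in its own basis, and the maximum of degree plus `c'ⱼ` over its
nonzero coordinates in the other. -/
theorem FilteredBundle.IsSplitting.exists_add_eq {K : ℕ} {E : FilteredBundle K} {ι ι' : Type*}
    [Finite ι'] {e : Module.Basis ι ℂ[X] E.Sec} {c : ι → ℝ} (h : E.IsSplitting e c)
    {e' : Module.Basis ι' ℂ[X] E.Sec} {c' : ι' → ℝ} (h' : E.IsSplitting e' c') (i : ι) :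
    ∃ (j : ι') (d : ℕ), (d : ℝ) + c' j = c i := by
  obtain ⟨j, -, hj⟩ := exists_eq_of_forall_le_iff (x := c i) (q := fun j => e'.repr (e i) j ≠ 0)
    (y := fun j => (e'.repr (e i) j).natDegree + c' j) (fun a => by
      have h1 := h a ((1 : MeroGerm 1) ⊗ₜ[ℂ[X]] e i)
      have h2 := h' a ((1 : MeroGerm 1) ⊗ₜ[ℂ[X]] e i)
      rw [repr_one_tmul_self_mem_poleLE, sub_nonneg] at h1
      rw [← h1, h2]
      refine forall_congr' fun j => ?_
      rw [repr_one_tmul_mem_poleLE, le_sub_iff_add_le]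
      simp)
  exact ⟨j, _, hj⟩

/-- The order of `φ eᵢ` is `cᵢ + N / K` by the exact shift, and the maximum of degree plus `cⱼ` over
its nonzero coordinates. -/
theorem CObj.exists_add_eq {K N : ℕ} [NeZero K] (E : CObj K N) {ι : Type*} [Fintype ι]
    {e : Module.Basis ι ℂ[X] E.Sec} {c : ι → ℝ} (h : E.IsSplitting e c) (i : ι) :
    ∃ (j : ι) (d : ℕ), (d : ℝ) + c j = c i + (N : ℝ) / K := by
  have hK : (0 : ℝ) < K := Nat.cast_pos.2 (NeZero.pos K)
  obtain ⟨j, -, hj⟩ := exists_eq_of_forall_le_iff (x := c i + (N : ℝ) / K)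
    (q := fun j => e.repr (E.φ (e i)) j ≠ 0)
    (y := fun j => (e.repr (E.φ (e i)) j).natDegree + c j) (fun a => by
      -- Order `a` in `x` is order `2Ka` in `u`; testing `φ eᵢ` there means testing `eᵢ` at `2Ka -
      -- 2N`.
      have h1 := E.mem_pullbackP_iff (2 * K * a - 2 * N) ((1 : MeroGerm (2 * K)) ⊗ₜ[ℂ[X]] e i)
      rw [h.mem_pullbackP_iff, h.mem_pullbackP_iff, repr_one_tmul_self_mem_poleLE, germMap,
        LinearMap.baseChange_tmul] at h1
      have h2 : c i + (N : ℝ) / K ≤ a ↔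
          0 ≤ 2 * K * a - 2 * N - ((2 * K : ℕ) : ℝ) * c i := by
        have h3 : 2 * K * a - 2 * N - ((2 * K : ℕ) : ℝ) * c i =
            2 * K * (a - (c i + (N : ℝ) / K)) := by
          push_cast
          field_simp
          ring
        rw [h3, mul_nonneg_iff_of_pos_left (by positivity), sub_nonneg]
      rw [h2, h1]
      refine forall_congr' fun j => ?_
      rw [repr_one_tmul_mem_poleLE]
      refine imp_congr_right fun _ => ?_
      have h4 : 2 * K * a - 2 * N + 2 * N - ((2 * K : ℕ) : ℝ) * c j =
          ((2 * K : ℕ) : ℝ) * (a - c j) := by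
        push_cast
        ring
      rw [h4, mul_le_mul_iff_right₀ (by push_cast; positivity), le_sub_iff_add_le])
  exact ⟨j, _, hj⟩

/-! ### Combinatorics of the orders -/

/-- `N / K` plus the difference of some two members of `α`, the second one prescribed, is always a
natural number. -/
def IsShiftClosed (K N : ℕ) (α : Fin K → ℝ) : Prop :=
  ∀ i, ∃ (j : Fin K) (d : ℕ), (d : ℝ) = (N : ℝ) / K + α j - α i

namespace IsShiftClosed

variable {K N : ℕ} [NeZero K] {α : Fin K → ℝ}

/-- Iterating `i ↦ j` subtracts `N / K` modulo `ℤ` each time. By coprimality the first `K` iterates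
are distinct, so they exhaust the `K` indices. -/
theorem exists_perm (h : IsShiftClosed K N α) (hKN : Nat.Coprime K N) (i₀ : Fin K) :
    ∃ s : Equiv.Perm (Fin K), ∀ k, ∃ n : ℤ, α (s k) = α i₀ - (k : ℕ) * ((N : ℝ) / K) + n := by
  have hK : (K : ℝ) ≠ 0 := Nat.cast_ne_zero.2 (NeZero.ne K)
  choose f d hd using h
  have hiter : ∀ k : ℕ, ∃ n : ℤ, α (f^[k] i₀) = α i₀ - k * ((N : ℝ) / K) + n := by
    intro k
    induction k with
    | zero => exact ⟨0, by simp⟩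
    | succ k ih =>
      obtain ⟨n, hn⟩ := ih
      refine ⟨n + d (f^[k] i₀), ?_⟩
      rw [Function.iterate_succ_apply']
      have := hd (f^[k] i₀)
      push_cast
      linarith
  have hinj : Function.Injective fun k : Fin K => f^[(k : ℕ)] i₀ := by
    intro k l hkl
    beta_reduce at hkl
    obtain ⟨n, hn⟩ := hiter k
    obtain ⟨n', hn'⟩ := hiter l
    rw [hkl, hn'] at hn
    -- A coincidence makes `(k - l) N / K` an integer, so `K` divides `k - l`, which has absolute
    -- value below `K`.
    have h1 : ((((k : ℕ) : ℤ) - ((l : ℕ) : ℤ)) * N : ℤ) = (K : ℤ) * (n - n') := by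
      have : ((k : ℕ) - (l : ℕ) : ℝ) * N = K * (n - n') := by
        field_simp at hn
        linarith
      exact_mod_cast this
    have h2 : (K : ℤ) ∣ ((k : ℕ) : ℤ) - ((l : ℕ) : ℤ) :=
      (Nat.isCoprime_iff_coprime.2 hKN).dvd_of_dvd_mul_right ⟨_, h1⟩
    have h3 := Int.eq_zero_of_abs_lt_dvd h2 (by
      have := k.2
      have := l.2
      rw [abs_lt]
      omega)
    exact Fin.ext (by omega)
  exact ⟨Equiv.ofBijective _ (Finite.injective_iff_bijective.1 hinj), fun k => hiter k⟩

/-- The classes `αᵢ - k N / K` with `0 ≤ k < K` are pairwise distinct modulo `ℤ`. This rigidity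
turns the later congruences into equalities of indices. -/
theorem eq_of_sub_eq_intCast (h : IsShiftClosed K N α) (hKN : Nat.Coprime K N) {i j : Fin K}
    {n : ℤ} (hn : α i - α j = n) : i = j := by
  have hK : (K : ℝ) ≠ 0 := Nat.cast_ne_zero.2 (NeZero.ne K)
  obtain ⟨s, hs⟩ := h.exists_perm hKN i
  obtain ⟨k, rfl⟩ := s.surjective i
  obtain ⟨l, rfl⟩ := s.surjective j
  obtain ⟨a, ha⟩ := hs k
  obtain ⟨b, hb⟩ := hs l
  have h1 : ((((k : ℕ) : ℤ) - ((l : ℕ) : ℤ)) * N : ℤ) = (K : ℤ) * (a - b - n) := by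
    have h0 : α (s k) - α (s l) = ((l : ℕ) - (k : ℕ)) * ((N : ℝ) / K) + a - b := by linarith
    rw [hn] at h0
    have : ((k : ℕ) - (l : ℕ) : ℝ) * N = K * (a - b - n) := by
      field_simp at h0
      linarith
    exact_mod_cast this
  have h2 : (K : ℤ) ∣ ((k : ℕ) : ℤ) - ((l : ℕ) : ℤ) :=
    (Nat.isCoprime_iff_coprime.2 hKN).dvd_of_dvd_mul_right ⟨_, h1⟩
  have h3 := Int.eq_zero_of_abs_lt_dvd h2 (by
    have := k.2
    have := l.2
    rw [abs_lt]
    omega)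
  rw [show k = l from Fin.ext (by omega)]

theorem exists_isDifference (h : IsShiftClosed K N α) (hKN : Nat.Coprime K N) :
    ∃ (σ : Equiv.Perm (Fin K)) (b : Fin K → ℤ), IsDifference K N (α ∘ σ) b := by
  have hK : (K : ℝ) ≠ 0 := Nat.cast_ne_zero.2 (NeZero.ne K)
  obtain ⟨s, hs⟩ := h.exists_perm hKN 0
  choose n hn using hs
  -- `t` is the carry when `x + 1` wraps around; it changes `α` by `K t · N / K = N t`, an integer.
  have key : ∀ x : Fin K, ∃ t : ℤ, ((x : ℕ) : ℤ) + 1 = ((x + 1 : Fin K) : ℕ) + K * t := by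
    intro x
    refine ⟨(((x : ℕ) : ℤ) + 1) / K, ?_⟩
    rw [Fin.val_add, show ((1 : Fin K) : ℕ) = 1 % K from rfl, Nat.add_mod_mod]
    push_cast
    exact (Int.emod_add_mul_ediv _ _).symm
  choose t ht using key
  -- The chain `s` descends by `N / K` modulo `ℤ`, while `αᵢ₊₁ ≡ αᵢ + N / K` is wanted, so the
  -- indexing is reversed.
  refine ⟨(Equiv.neg (Fin K)).trans s,
    fun i => n (-i) - n (-(i + 1)) + N * t (-(i + 1)),
    fun i => ?_⟩
  have h1 := hn (-i)
  have h2 := hn (-(i + 1))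
  have h3 := ht (-(i + 1))
  have h4 : -(i + 1) + 1 = -i := by abel
  rw [h4] at h3
  have h5 : (((-(i + 1) : Fin K) : ℕ) : ℝ) + 1 = ((-i : Fin K) : ℕ) + K * t (-(i + 1)) := by
    exact_mod_cast h3
  simp only [Function.comp_apply, Equiv.trans_apply, Equiv.neg_apply]
  rw [h1, h2]
  have h6 : (((-i : Fin K) : ℕ) : ℝ) = ((-(i + 1) : Fin K) : ℕ) + 1 - K * t (-(i + 1)) := by
    linarith
  rw [h6]
  push_cast
  field_simp
  ring

/-- The index that shift-closedness provides at `i + 1` has `α` congruent to `αᵢ`, so it is `i`, and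
the natural number that comes with it is `bᵢ`. -/
theorem nonneg_of_isDifference (h : IsShiftClosed K N α) (hKN : Nat.Coprime K N) {b : Fin K → ℤ}
    (hb : IsDifference K N α b) (i : Fin K) : 0 ≤ b i := by
  obtain ⟨j, d, hd⟩ := h (i + 1)
  have h1 := hb i
  have h2 : α j - α i = ((d - b i : ℤ) : ℝ) := by
    push_cast
    linarith
  have h3 := h.eq_of_sub_eq_intCast hKN h2
  subst h3
  rw [sub_self] at h2
  have h4 : (d : ℤ) - b j = 0 := by exact_mod_cast h2.symm
  omega

end IsShiftClosed

theorem IsDifference.sum_eq {K N : ℕ} [NeZero K] {α : Fin K → ℝ} {b : Fin K → ℤ}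
    (h : IsDifference K N α b) : ∑ i, b i = (N : ℤ) := by
  have hK : (K : ℝ) ≠ 0 := Nat.cast_ne_zero.2 (NeZero.ne K)
  have h1 : ∑ i, ((b i : ℝ) - (N : ℝ) / K) = ∑ i, (α i - α (i + 1)) :=
    Finset.sum_congr rfl fun i _ => h i
  have h2 : ∑ i, α (i + 1) = ∑ i, α i := Equiv.sum_comp (Equiv.addRight (1 : Fin K)) α
  rw [Finset.sum_sub_distrib, Finset.sum_sub_distrib, h2, sub_self, Finset.sum_const,
    Finset.card_univ, Fintype.card_fin, nsmul_eq_mul, mul_div_cancel₀ _ hK, sub_eq_zero] at h1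
  exact_mod_cast h1

theorem Fin.eq_add_of_map_add_one {K : ℕ} [NeZero K] {τ : Fin K → Fin K}
    (h : ∀ j, τ (j + 1) = τ j + 1) (j : Fin K) : τ j = j + τ 0 := by
  have key : ∀ n : ℕ, τ (Fin.ofNat K n) = Fin.ofNat K n + τ 0 := by
    intro n
    induction n with
    | zero =>
      have : Fin.ofNat K 0 = 0 := rfl
      rw [this, zero_add]
    | succ n ih =>
      have : Fin.ofNat K (n + 1) = Fin.ofNat K n + 1 := by
        ext
        simp [Fin.val_add]
      rw [this, h, ih, add_right_comm]
  have hj : Fin.ofNat K (j : ℕ) = j := by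
    ext
    simp
  rw [← hj]
  exact key j

/-- Each `α'ⱼ` lies a natural number below some `α (τ j)`, and conversely. Going there and back
leads to an index congruent to `j`, hence to `j`, so both gaps vanish and `α' = α ∘ τ`. Since `α (i
+ 1)` is determined modulo `ℤ` by `α i`, `τ` commutes with `+ 1` and is a rotation. -/
theorem IsDifference.exists_shift {K N : ℕ} [NeZero K] (hKN : Nat.Coprime K N)
    {α α' : Fin K → ℝ} (h : IsShiftClosed K N α) (h' : IsShiftClosed K N α')
    (hα : ∀ j, ∃ (i : Fin K) (d : ℕ), (d : ℝ) = α i - α' j)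
    (hα' : ∀ j, ∃ (i : Fin K) (d : ℕ), (d : ℝ) = α' i - α j) {b b' : Fin K → ℤ}
    (hb : IsDifference K N α b) (hb' : IsDifference K N α' b') :
    ∃ s : Fin K, ∀ i, b' i = b (i + s) := by
  choose τ d hd using hα
  have hτ : ∀ j, α' j = α (τ j) := by
    intro j
    obtain ⟨j', d', hd'⟩ := hα' (τ j)
    have h1 := hd j
    have h2 : α' j' - α' j = ((d' + d j : ℤ) : ℝ) := by
      push_cast
      linarith
    have h3 := h'.eq_of_sub_eq_intCast hKN h2
    subst h3
    rw [sub_self] at h2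
    have h4 : (d' : ℤ) + d j' = 0 := by exact_mod_cast h2.symm
    have h5 : d j' = 0 := by omega
    rw [h5] at h1
    push_cast at h1
    linarith
  have hstep : ∀ j, τ (j + 1) = τ j + 1 := by
    intro j
    have h1 := hb' j
    have h2 := hb (τ j)
    rw [hτ, hτ] at h1
    exact h.eq_of_sub_eq_intCast hKN (n := b (τ j) - b' j) (by push_cast; linarith)
  refine ⟨τ 0, fun i => ?_⟩
  rw [← Fin.eq_add_of_map_add_one hstep i]
  have h1 := hb' i
  have h2 := hb (τ i)
  rw [hτ, hτ, hstep] at h1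
  have : (b' i : ℝ) = b (τ i) := by linarith
  exact_mod_cast this

/-! ### Shapes of objects -/

theorem FilteredBundle.SplitsAs.comp_perm {K : ℕ} {E : FilteredBundle K} {α : Fin K → ℝ}
    (h : E.SplitsAs α) (σ : Equiv.Perm (Fin K)) : E.SplitsAs (α ∘ σ) := by
  obtain ⟨e, he⟩ := h.exists_isSplitting
  refine FilteredBundle.IsSplitting.splitsAs (e := e.reindex σ.symm) fun β v => ?_
  have hrepr : ∀ i, ((e.reindex σ.symm).baseChange (MeroGerm 1)).repr v i =
      (e.baseChange (MeroGerm 1)).repr v (σ i) := by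
    intro i
    induction v using TensorProduct.induction_on with
    | zero => simp
    | add v w hv hw => rw [map_add, map_add, Finsupp.add_apply, Finsupp.add_apply, hv, hw]
    | tmul f s =>
      rw [Module.Basis.baseChange_repr_tmul, Module.Basis.baseChange_repr_tmul,
        Module.Basis.repr_reindex_apply, Equiv.symm_symm]
  rw [he β v]
  constructor
  · intro h i
    rw [hrepr]
    exact h (σ i)
  · intro h i
    have := h (σ.symm i)
    beta_reduce at this
    rwa [hrepr, Function.comp_apply, Equiv.apply_symm_apply] at this

theorem FilteredBundle.SplitsAs.exists_natCast_eq {K : ℕ} {E : FilteredBundle K}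
    {α α' : Fin K → ℝ} (h : E.SplitsAs α) (h' : E.SplitsAs α') (j : Fin K) :
    ∃ (i : Fin K) (d : ℕ), (d : ℝ) = α i - α' j := by
  obtain ⟨e, he⟩ := h.exists_isSplitting
  obtain ⟨e', he'⟩ := h'.exists_isSplitting
  obtain ⟨i, d, hd⟩ := he'.exists_add_eq he j
  exact ⟨i, d, by linarith⟩

namespace CObj

variable {K N : ℕ} [NeZero K]

theorem isShiftClosed (E : CObj K N) {α : Fin K → ℝ} (h : E.SplitsAs α) :
    IsShiftClosed K N α := by
  obtain ⟨e, he⟩ := h.exists_isSplitting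
  intro i
  obtain ⟨j, d, hd⟩ := E.exists_add_eq he i
  exact ⟨j, d, by linarith⟩

theorem HasShape.unique (hKN : Nat.Coprime K N) {E : CObj K N} {c c' : CyclicPartition K N}
    (h : E.HasShape c) (h' : E.HasShape c') : c = c' := by
  obtain ⟨α, b, hα, hb, rfl⟩ := h
  obtain ⟨α', b', hα', hb', rfl⟩ := h'
  obtain ⟨s, hs⟩ := hb.exists_shift hKN (E.isShiftClosed hα) (E.isShiftClosed hα')
    (hα.exists_natCast_eq hα') (hα'.exists_natCast_eq hα) hb'
  exact Quotient.sound ⟨s, fun i => by exact_mod_cast hs i⟩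

theorem exists_hasShape (hKN : Nat.Coprime K N) (E : CObj K N) : ∃ c, E.HasShape c := by
  obtain ⟨α, hα⟩ := E.exists_splitsAs
  obtain ⟨σ, b, hb⟩ := (E.isShiftClosed hα).exists_isDifference hKN
  have hσ := hα.comp_perm σ
  have hnonneg := (E.isShiftClosed hσ).nonneg_of_isDifference hKN hb
  lift b to Fin K → ℕ using hnonneg
  have hsum := hb.sum_eq
  exact ⟨_, α ∘ σ, ⟨b, by exact_mod_cast hsum⟩, hσ, hb, rfl⟩

theorem HasShape.of_isIso {E E' : CObj K N} {c : CyclicPartition K N} (h : E.HasShape c)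
    (f : E.IsIso E') : E'.HasShape c := by
  obtain ⟨α, b, hα, hb, rfl⟩ := h
  obtain ⟨f, -⟩ := f
  exact ⟨α, b, hα.of_iso f, hb, rfl⟩

end CObj

/-! ### The stratification of `ℳ_{K,N}`. -/

theorem proposition2p3 (K N : ℕ) [NeZero K] (hN : 0 < N) (hKN : Nat.Coprime K N) :
    (∀ E : CObj.{u} K N,
      -- the filtered bundle splits into filtered line bundles
      (∃ α : Fin K → ℝ, E.SplitsAs α) ∧
      -- the summands of any splitting can be ordered so that the `bᵢ` are integers
      (∀ α : Fin K → ℝ, E.SplitsAs α →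
        ∃ (σ : Equiv.Perm (Fin K)) (b : Fin K → ℤ), IsDifference K N (α ∘ σ) b) ∧
      -- for any such ordering, `b` is an ordered `K`-partition of `N`
      (∀ (α : Fin K → ℝ) (b : Fin K → ℤ), E.SplitsAs α → IsDifference K N α b →
        (∀ i, 0 ≤ b i) ∧ ∑ i, b i = (N : ℤ)) ∧
      -- the cyclic partition `[b]` exists and depends neither on the splitting nor on the ordering
      (∃! c : CyclicPartition K N, E.HasShape c)) ∧
    -- `ℳ_{K,N}` is the disjoint union of the strata
    (⋃ c : CyclicPartition K N, stratum.{u} K N c) = Set.univ ∧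
    (∀ c c' : CyclicPartition K N, c ≠ c' → Disjoint (stratum.{u} K N c) (stratum.{u} K N c')) := by
  refine ⟨fun E => ⟨E.exists_splitsAs,
    fun α hα => (E.isShiftClosed hα).exists_isDifference hKN,
    fun α b hα hb => ⟨(E.isShiftClosed hα).nonneg_of_isDifference hKN hb, hb.sum_eq⟩, ?_⟩, ?_, ?_⟩
  · obtain ⟨c, hc⟩ := E.exists_hasShape hKN
    exact ⟨c, hc, fun c' hc' => hc'.unique hKN hc⟩
  · rw [Set.eq_univ_iff_forall]
    intro x
    obtain ⟨E, rfl⟩ := Quotient.exists_rep x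
    obtain ⟨c, hc⟩ := E.exists_hasShape hKN
    exact Set.mem_iUnion.2 ⟨c, E, rfl, hc⟩
  · intro c c' hne
    rw [Set.disjoint_left]
    rintro x ⟨E, rfl, hE⟩ ⟨E', hx, hE'⟩
    -- The two shapes may come from different representatives of the class, so one is first
    -- transported along an isomorphism.
    exact hne ((hE.of_isIso (Quotient.exact hx.symm)).unique hKN hE')
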